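/- Let $$f(z)=P_0(z)e^{Q_0(z)}+\cdots+P_n(z)e^{Q_n(z)}$$ be an exponential polynomial, where the $P_j,Q_j$ are complex polynomials, no $P_j$ vanishes identically, and the $Q_j$ are pairwise different and normalized by $Q_j(0)=0$. Let $q=\max_j\deg Q_j$ be its order, let $w_j$ denote the coefficient of $z^q$ in $Q_j$ (so $w_j=0$ if $\deg Q_j<q$), and let $W_f=\{\overline{w}_0,\ldots,\overline{w}_n\}$ be the set of the complex conjugates of these numbers. Let $C(\operatorname{co}(W_f))$ be the circumference of the convex hull $\operatorname{co}(W_f)$, that is, the sum of the lengths of the sides of this polygon, understood as twice the length if $\operatorname{co}(W_f)$ is a segment, and as $0$ if it is a point. Let $n(r,1/f)$ be the number of zeros of $f$ in the disc $|z|\le r$, counted with multiplicity. If $C(\operatorname{co}(W_f))>0$, then $$n(r,1/f)=q\,C(\operatorname{co}(W_f))\,\frac{r^q}{2\pi}+o(r^q)\qquad (r\to\infty).$$ -/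

import Mathlib

open Polynomial Filter

/-- `f` is the exponential polynomial `f(z) = P₀(z) e^{Q₀(z)} + ⋯ + Pₙ(z) e^{Qₙ(z)}`, where no
coefficient `Pⱼ` vanishes identically and the exponents `Qⱼ` are pairwise different polynomials
normalized by `Qⱼ(0) = 0`. -/
structure IsExpPolynomial (f : ℂ → ℂ) {n : ℕ} (P Q : Fin (n + 1) → ℂ[X]) : Prop where
  eq_sum : ∀ z : ℂ, f z = ∑ j, (P j).eval z * Complex.exp ((Q j).eval z)
  coeff_ne_zero : ∀ j, P j ≠ 0
  exponents_injective : Function.Injective Q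
  exponents_eval_zero : ∀ j, (Q j).eval 0 = 0

/-- The order `q = max deg Qⱼ` of the exponential polynomial `∑ Pⱼ e^{Qⱼ}`. -/
def expOrder {n : ℕ} (Q : Fin (n + 1) → ℂ[X]) : ℕ :=
  Finset.univ.sup fun j => (Q j).natDegree

open Classical in
/-- The set `W_f` of conjugated leading coefficients. Collecting the terms of `∑ Pⱼ e^{Qⱼ}` whose
exponents have the same coefficient `w` of `z^q`, with `q` the order, gives
`f(z) = ∑ H_w(z) e^{w z^q}`, where each `H_w` is an exponential polynomial of order at most `q - 1`;
`W_f` consists of the conjugates of these `w`. In particular `0 ∈ W_f` exactly when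
`deg Qⱼ < q` for some `j` (for `q ≥ 1`). -/
noncomputable def conjLeadingCoeffs {n : ℕ} (Q : Fin (n + 1) → ℂ[X]) : Finset ℂ :=
  Finset.univ.image fun j => (starRingEnd ℂ) ((Q j).coeff (expOrder Q))

/-- The directed segment from `a` to `b` is a side of the convex polygon `K`, traversed
counterclockwise: `a` and `b` are different vertices of `K`, and `K` lies in the closed half-plane
to the left of the directed line from `a` to `b`. If `K` is the segment `[a, b]`, then both
directed segments, from `a` to `b` and from `b` to `a`, are sides. -/
structure IsDirectedSide (K : Set ℂ) (a b : ℂ) : Prop where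
  left_vertex : a ∈ Set.extremePoints ℝ K
  right_vertex : b ∈ Set.extremePoints ℝ K
  ne : a ≠ b
  half_plane : ∀ z ∈ K, 0 ≤ ((starRingEnd ℂ) (b - a) * (z - a)).im

open Classical in
/-- The circumference `C(co(G))` of the convex hull of a finite set `G` of complex numbers: the sum
of the lengths of the sides of the polygon `co(G)`, all of whose vertices belong to `G`. It is `0`
if `G` has at most one point, and twice the length if `co(G)` is a segment. -/
noncomputable def hullCircumference (G : Finset ℂ) : ℝ :=
  ∑ p ∈ (G ×ˢ G).filter (fun p => IsDirectedSide (convexHull ℝ (G : Set ℂ)) p.1 p.2), ‖p.2 - p.1‖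

/-- The counting function `n(r, 1/f)`: the number of zeros of the entire function `f` in the closed
disc `|z| ≤ r`, counted with multiplicity. -/
noncomputable def zeroCount (f : ℂ → ℂ) (r : ℝ) : ℕ :=
  ∑ᶠ z ∈ Metric.closedBall (0 : ℂ) r, analyticOrderNatAt f z

theorem pow_card_le_norm_prod_sub {s : Multiset ℂ} {z : ℂ} {c : ℝ} (hc : 0 ≤ c)
    (h : ∀ a ∈ s, c ≤ ‖z - a‖) : c ^ Multiset.card s ≤ ‖(s.map (z - ·)).prod‖ := by
  induction s using Multiset.induction_on with
  | empty => simp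
  | cons a s ih =>
    have h1 := ih fun b hb => h b (Multiset.mem_cons_of_mem hb)
    have h2 := h a (Multiset.mem_cons_self a s)
    simp only [Multiset.card_cons, Multiset.map_cons, Multiset.prod_cons, norm_mul, pow_succ']
    gcongr

theorem norm_prod_sub_le_pow_card {s : Multiset ℂ} {z : ℂ} {c : ℝ}
    (h : ∀ a ∈ s, ‖z - a‖ ≤ c) : ‖(s.map (z - ·)).prod‖ ≤ c ^ Multiset.card s := by
  induction s using Multiset.induction_on with
  | empty => simp
  | cons a s ih =>
    have h1 := ih fun b hb => h b (Multiset.mem_cons_of_mem hb)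
    have h2 := h a (Multiset.mem_cons_self a s)
    have h3 : 0 ≤ c := (norm_nonneg _).trans h2
    simp only [Multiset.card_cons, Multiset.map_cons, Multiset.prod_cons, norm_mul, pow_succ']
    gcongr

/-- Maximum principle for the cofactor of finitely many zeros in a disc. -/
theorem norm_cofactor_mul_le {f g : ℂ → ℂ} {z₀ : ℂ} {ρ M : ℝ} {s : Multiset ℂ} (hρ : 0 < ρ)
    (hM : ∀ z ∈ Metric.closedBall z₀ (3 * ρ), ‖f z‖ ≤ M) (hg : Differentiable ℂ g)
    (hfg : ∀ z, f z = (s.map (z - ·)).prod * g z) (hs : ∀ a ∈ s, a ∈ Metric.closedBall z₀ ρ)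
    {z : ℂ} (hz : z ∈ Metric.closedBall z₀ (3 * ρ)) :
    ‖g z‖ * (2 * ρ) ^ Multiset.card s ≤ M := by
  rw [← le_div_iff₀ (by positivity)]
  refine Complex.norm_le_of_forall_mem_frontier_norm_le (U := Metric.ball z₀ (3 * ρ))
    Metric.isBounded_ball hg.diffContOnCl ?_ ?_
  · intro w hw
    rw [frontier_ball _ (by positivity), mem_sphere_iff_norm] at hw
    rw [le_div_iff₀ (by positivity)]
    calc ‖g w‖ * (2 * ρ) ^ Multiset.card s
        ≤ ‖g w‖ * ‖(s.map (w - ·)).prod‖ := by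
          gcongr
          refine pow_card_le_norm_prod_sub (by positivity) fun a ha => ?_
          have h1 := hs a ha
          rw [mem_closedBall_iff_norm] at h1
          have h2 : ‖w - z₀‖ ≤ ‖w - a‖ + ‖a - z₀‖ := norm_sub_le_norm_sub_add_norm_sub _ _ _
          linarith
      _ = ‖f w‖ := by rw [hfg, norm_mul, mul_comm]
      _ ≤ M := hM w (by rw [mem_closedBall_iff_norm, hw])
  · rwa [closure_ball _ (by positivity)]

theorem two_pow_card_mul_norm_le {f g : ℂ → ℂ} {z₀ : ℂ} {ρ M : ℝ} {s : Multiset ℂ} (hρ : 0 < ρ)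
    (hM : ∀ z ∈ Metric.closedBall z₀ (3 * ρ), ‖f z‖ ≤ M) (hg : Differentiable ℂ g)
    (hfg : ∀ z, f z = (s.map (z - ·)).prod * g z) (hs : ∀ a ∈ s, a ∈ Metric.closedBall z₀ ρ) :
    2 ^ Multiset.card s * ‖f z₀‖ ≤ M := by
  have h1 := norm_cofactor_mul_le hρ hM hg hfg hs (z := z₀) (by simp [hρ.le])
  refine le_trans ?_ h1
  rw [hfg, norm_mul, mul_pow]
  have h2 : ‖(s.map (z₀ - ·)).prod‖ ≤ ρ ^ Multiset.card s :=
    norm_prod_sub_le_pow_card fun a ha => by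
      rw [← mem_closedBall_iff_norm']
      exact hs a ha
  calc 2 ^ Multiset.card s * (‖(s.map (z₀ - ·)).prod‖ * ‖g z₀‖)
      ≤ 2 ^ Multiset.card s * (ρ ^ Multiset.card s * ‖g z₀‖) := by gcongr
    _ = _ := by ring

/-- All zeros of an entire function in a closed disc can be divided out. -/
theorem exists_zero_free_cofactor {f : ℂ → ℂ} (hf : Differentiable ℂ f) {z₀ : ℂ} (h0 : f z₀ ≠ 0)
    {ρ M : ℝ} (hρ : 0 < ρ) (hM : ∀ z ∈ Metric.closedBall z₀ (3 * ρ), ‖f z‖ ≤ M) :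
    ∃ (s : Multiset ℂ) (g : ℂ → ℂ), Differentiable ℂ g ∧
      (∀ z, f z = (s.map (z - ·)).prod * g z) ∧ (∀ a ∈ s, a ∈ Metric.closedBall z₀ ρ) ∧
      ∀ z ∈ Metric.closedBall z₀ ρ, g z ≠ 0 := by
  by_contra! hcon
  have key : ∀ N : ℕ, ∃ (s : Multiset ℂ) (g : ℂ → ℂ), Multiset.card s = N ∧ Differentiable ℂ g ∧
      (∀ z, f z = (s.map (z - ·)).prod * g z) ∧ (∀ a ∈ s, a ∈ Metric.closedBall z₀ ρ) := by
    intro N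
    induction N with
    | zero => exact ⟨0, f, rfl, hf, by simp, by simp⟩
    | succ N ih =>
      obtain ⟨s, g, hN, hg, hfg, hs⟩ := ih
      obtain ⟨a, ha, hga⟩ := hcon s g hg hfg hs
      refine ⟨a ::ₘ s, dslope g a, by simp [hN], ?_, ?_, ?_⟩
      · rw [← differentiableOn_univ, Complex.differentiableOn_dslope univ_mem]
        exact hg.differentiableOn
      · intro z
        have := sub_smul_dslope g a z
        rw [hga, sub_zero, smul_eq_mul] at this
        rw [hfg, ← this, Multiset.map_cons, Multiset.prod_cons]
        ring
      · intro b hb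
        rcases Multiset.mem_cons.1 hb with rfl | hb
        exacts [ha, hs b hb]
  obtain ⟨N, hN⟩ := pow_unbounded_of_one_lt (M / ‖f z₀‖) (one_lt_two)
  obtain ⟨s, g, hcard, hg, hfg, hs⟩ := key N
  have := two_pow_card_mul_norm_le hρ hM hg hfg hs
  rw [hcard] at this
  rw [div_lt_iff₀ (norm_pos_iff.2 h0)] at hN
  linarith

/-- A zero-free function on a disc, bounded by `exp B` times its value at the centre, has
logarithmic derivative bounded by a multiple of `B` on a smaller concentric disc. -/
theorem norm_logDeriv_le_of_zero_free {g : ℂ → ℂ} (hg : Differentiable ℂ g) {z₀ : ℂ} {ρ B : ℝ}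
    (hρ : 0 < ρ) (hB : 0 < B) (h0 : ∀ z ∈ Metric.ball z₀ ρ, g z ≠ 0)
    (hb : ∀ z ∈ Metric.ball z₀ ρ, ‖g z‖ ≤ Real.exp B * ‖g z₀‖) {z : ℂ}
    (hz : ‖z - z₀‖ ≤ 2 / 3 * ρ) : ‖logDeriv g z‖ ≤ 60 * B / ρ := by
  have hz₀ : z₀ ∈ Metric.ball z₀ ρ := Metric.mem_ball_self hρ
  have hd : DifferentiableOn ℂ (logDeriv g) (Metric.ball z₀ ρ) := by
    intro w hw
    have h1 : DifferentiableAt ℂ (deriv g) w := by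
      have := hg.analyticAt w
      exact this.deriv.differentiableAt
    exact (h1.div (hg w) (h0 w hw)).differentiableWithinAt
  obtain ⟨G, hG⟩ := hd.isExactOn_ball
  have hexp : ∀ w ∈ Metric.ball z₀ ρ, g w * Complex.exp (-G w) = g z₀ * Complex.exp (-G z₀) := by
    intro w hw
    have hder : ∀ v ∈ Metric.ball z₀ ρ,
        HasDerivAt (fun u => g u * Complex.exp (-G u)) 0 v := by
      intro v hv
      have := (hg v).hasDerivAt.mul ((hG v hv).neg.cexp)
      convert! this using 1
      rw [logDeriv_apply]
      have := h0 v hv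
      field_simp
      ring
    exact Metric.isOpen_ball.is_const_of_deriv_eq_zero (convex_ball z₀ ρ).isPreconnected
      (fun v hv => (hder v hv).differentiableAt.differentiableWithinAt)
      (fun v hv => (hder v hv).deriv) hw hz₀
  have hre : ∀ w ∈ Metric.ball z₀ ρ, (G w - G z₀).re ≤ B := by
    intro w hw
    have h1 : g w = g z₀ * Complex.exp (G w - G z₀) := by
      have := hexp w hw
      rw [Complex.exp_neg, Complex.exp_neg] at this
      rw [Complex.exp_sub]
      have e1 := Complex.exp_ne_zero (G w)
      have e2 := Complex.exp_ne_zero (G z₀)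
      field_simp at this ⊢
      exact this
    have h2 := hb w hw
    rw [h1, norm_mul, Complex.norm_exp, mul_comm] at h2
    exact Real.exp_le_exp.1 (le_of_mul_le_mul_right h2 (norm_pos_iff.2 (h0 z₀ hz₀)))
  have hbound : ∀ w, ‖w - z₀‖ ≤ 5 / 6 * ρ → ‖G w - G z₀‖ ≤ 10 * B := by
    intro w hw
    have h1 := Complex.borelCaratheodory_zero (f := fun u => G (z₀ + u) - G z₀) (M := B) (R := ρ)
      (z := w - z₀) hB ?_ ?_ hρ ?_ (by simp)
    · simp only [add_sub_cancel] at h1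
      refine h1.trans ?_
      have : 0 < ρ - ‖w - z₀‖ := by linarith
      rw [div_le_iff₀ this]
      nlinarith
    · intro u hu
      have hu' : z₀ + u ∈ Metric.ball z₀ ρ := by simpa using hu
      have := (hG _ hu').comp_const_add z₀ u
      exact (this.differentiableAt.sub_const _).differentiableWithinAt
    · intro u hu
      exact hre _ (by simpa using hu)
    · rw [mem_ball_zero_iff]
      linarith
  have hzb : z ∈ Metric.ball z₀ ρ := by
    rw [mem_ball_iff_norm]
    linarith
  have hder : deriv (fun w => G w - G z₀) z = logDeriv g z := by
    rw [deriv_sub_const]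
    exact (hG z hzb).deriv
  rw [← hder]
  have := Complex.norm_deriv_le_of_forall_mem_sphere_norm_le (c := z) (R := ρ / 6) (C := 10 * B)
    (f := fun w => G w - G z₀) (by positivity) ?_ ?_
  · refine this.trans (le_of_eq ?_)
    field_simp
    norm_num
  · refine DifferentiableOn.diffContOnCl fun w hw => ?_
    rw [closure_ball _ (by positivity), mem_closedBall_iff_norm] at hw
    have hw' : w ∈ Metric.ball z₀ ρ := by
      rw [mem_ball_iff_norm]
      have := norm_sub_le_norm_sub_add_norm_sub w z z₀
      linarith
    exact ((hG w hw').differentiableAt.sub_const _).differentiableWithinAt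
  · intro w hw
    rw [mem_sphere_iff_norm] at hw
    refine hbound w ?_
    have := norm_sub_le_norm_sub_add_norm_sub w z z₀
    linarith

theorem differentiable_multiset_prod_sub (s : Multiset ℂ) :
    Differentiable ℂ fun w : ℂ => (s.map (w - ·)).prod := by
  induction s using Multiset.induction_on with
  | empty => simp
  | cons a s ih =>
    simp only [Multiset.map_cons, Multiset.prod_cons]
    fun_prop

theorem multiset_prod_sub_ne_zero {s : Multiset ℂ} {z : ℂ} (h : ∀ a ∈ s, z ≠ a) :
    (s.map (z - ·)).prod ≠ 0 := by
  rw [Ne, Multiset.prod_eq_zero_iff, Multiset.mem_map]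
  rintro ⟨a, ha, h0⟩
  exact h a ha (sub_eq_zero.1 h0)

theorem logDeriv_multiset_prod_sub {s : Multiset ℂ} {z : ℂ} (h : ∀ a ∈ s, z ≠ a) :
    logDeriv (fun w => (s.map (w - ·)).prod) z = (s.map fun a => (z - a)⁻¹).sum := by
  induction s using Multiset.induction_on with
  | empty => simp [logDeriv_apply]
  | cons a s ih =>
    have h0 : ∀ b ∈ s, z ≠ b := fun b hb => h b (Multiset.mem_cons_of_mem hb)
    have h2 : z - a ≠ 0 := sub_ne_zero.2 (h a (Multiset.mem_cons_self a s))
    simp only [Multiset.map_cons, Multiset.prod_cons, Multiset.sum_cons]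
    have h3 := logDeriv_mul (f := fun w => w - a) (g := fun w => (s.map (w - ·)).prod) z h2
      (multiset_prod_sub_ne_zero h0) (by fun_prop) (differentiable_multiset_prod_sub s z)
    rw [ih h0] at h3
    refine h3.trans ?_
    simp [logDeriv_apply]

theorem norm_multiset_sum_inv_le (s : Multiset ℂ) (z : ℂ) :
    ‖(s.map fun a => (z - a)⁻¹).sum‖ ≤ (s.map fun a => ‖z - a‖⁻¹).sum := by
  induction s using Multiset.induction_on with
  | empty => simp
  | cons a s ih =>
    simp only [Multiset.map_cons, Multiset.sum_cons]
    refine (norm_add_le _ _).trans ?_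
    rw [norm_inv]
    gcongr

/-- The logarithmic derivative of an entire function is controlled by its zeros in a disc and its
growth. -/
theorem exists_norm_logDeriv_le {f : ℂ → ℂ} (hf : Differentiable ℂ f) {z₀ : ℂ} (h0 : f z₀ ≠ 0)
    {ρ B : ℝ} (hρ : 0 < ρ) (hB : 0 < B)
    (hb : ∀ z ∈ Metric.closedBall z₀ (3 * ρ), ‖f z‖ ≤ Real.exp B * ‖f z₀‖) :
    ∃ s : Multiset ℂ, (Multiset.card s : ℝ) ≤ 2 * B ∧ ∀ z, ‖z - z₀‖ ≤ 2 / 3 * ρ → f z ≠ 0 →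
      ‖logDeriv f z‖ ≤ (s.map fun a => ‖z - a‖⁻¹).sum + 60 * B / ρ := by
  obtain ⟨s, g, hg, hfg, hs, hg0⟩ := exists_zero_free_cofactor hf h0 hρ hb
  have hf0 : 0 < ‖f z₀‖ := norm_pos_iff.2 h0
  refine ⟨s, ?_, ?_⟩
  · have h1 := two_pow_card_mul_norm_le hρ hb hg hfg hs
    have h2 : (2 : ℝ) ^ Multiset.card s ≤ Real.exp B := le_of_mul_le_mul_right h1 hf0
    have h3 := Real.log_le_log (by positivity) h2
    rw [Real.log_pow, Real.log_exp] at h3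
    have h4 := Real.log_two_gt_d9
    have h5 : (0 : ℝ) ≤ Multiset.card s := by positivity
    nlinarith
  · intro z hz hfz
    have hza : ∀ a ∈ s, z ≠ a := by
      rintro a ha rfl
      refine hfz ?_
      rw [hfg, Multiset.prod_eq_zero, zero_mul]
      exact Multiset.mem_map.2 ⟨z, ha, sub_self z⟩
    have hgz : g z ≠ 0 := fun h => hfz (by rw [hfg, h, mul_zero])
    have h1 : logDeriv f z = (s.map fun a => (z - a)⁻¹).sum + logDeriv g z := by
      rw [← logDeriv_multiset_prod_sub hza, ← logDeriv_mul z (multiset_prod_sub_ne_zero hza) hgz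
        (differentiable_multiset_prod_sub s z) (hg z)]
      congr 1
      ext w
      exact hfg w
    rw [h1]
    refine (norm_add_le _ _).trans (add_le_add (norm_multiset_sum_inv_le s z) ?_)
    refine norm_logDeriv_le_of_zero_free hg hρ hB
      (fun w hw => hg0 w (Metric.ball_subset_closedBall hw)) (fun w hw => ?_) hz
    have h2 := norm_cofactor_mul_le hρ hb hg hfg hs (z := w)
      (Metric.closedBall_subset_closedBall (by linarith) (Metric.ball_subset_closedBall hw))
    have h3 : ‖(s.map (z₀ - ·)).prod‖ ≤ (2 * ρ) ^ Multiset.card s :=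
      norm_prod_sub_le_pow_card fun a ha => by
        have := hs a ha
        rw [mem_closedBall_iff_norm'] at this
        linarith
    refine le_of_mul_le_mul_right (h2.trans ?_) (by positivity : 0 < (2 * ρ) ^ Multiset.card s)
    rw [hfg, norm_mul, mul_assoc, mul_comm ‖g z₀‖]
    gcongr

theorem sqrt_add_le_add_sqrt (x : ℝ) {y : ℝ} (hy : 0 ≤ y) : √(x + y) ≤ √x + √y := by
  rcases le_total 0 x with hx | hx
  · rw [Real.sqrt_le_left (by positivity)]
    nlinarith [Real.sq_sqrt hx, Real.sq_sqrt hy, Real.sqrt_nonneg x, Real.sqrt_nonneg y]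
  · rw [Real.sqrt_eq_zero_of_nonpos hx, zero_add]
    exact Real.sqrt_le_sqrt (by linarith)

theorem sqrt_multiset_sum_inv_le (s : Multiset ℂ) (z : ℂ) :
    √((s.map fun a => ‖z - a‖⁻¹).sum) ≤ (s.map fun a => (√‖z - a‖)⁻¹).sum := by
  induction s using Multiset.induction_on with
  | empty => simp
  | cons a s ih =>
    simp only [Multiset.map_cons, Multiset.sum_cons]
    rw [add_comm, add_comm (√‖z - a‖)⁻¹]
    refine (sqrt_add_le_add_sqrt _ (by positivity)).trans ?_
    rw [Real.sqrt_inv]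
    gcongr

theorem posLog_le_two_mul_log_one_add_sqrt {y : ℝ} (hy : 0 ≤ y) :
    Real.posLog y ≤ 2 * Real.log (1 + √y) := by
  rw [Real.posLog_eq_log_max_one hy, ← Real.log_rpow (by positivity)]
  refine Real.log_le_log (by positivity) ?_
  rw [Real.rpow_two]
  refine max_le ?_ ?_ <;> nlinarith [Real.sq_sqrt hy, Real.sqrt_nonneg y]

theorem log_le_log_add_div_sub_one {x c : ℝ} (hx : 0 < x) (hc : 0 < c) :
    Real.log x ≤ Real.log c + (x / c - 1) := by
  have := Real.log_le_sub_one_of_pos (div_pos hx hc)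
  rw [Real.log_div hx.ne' hc.ne'] at this
  linarith

theorem circleAverage_mono_codiscrete {f₁ f₂ : ℂ → ℝ} {c : ℂ} {R : ℝ} (hR : R ≠ 0)
    (h₁ : CircleIntegrable f₁ c R) (h₂ : CircleIntegrable f₂ c R)
    (h : ∀ᶠ z in codiscrete ℂ, z ∈ Metric.sphere c |R| → f₁ z ≤ f₂ z) :
    Real.circleAverage f₁ c R ≤ Real.circleAverage f₂ c R := by
  have h' : ∀ᶠ z in codiscreteWithin (Metric.sphere c |R|), f₁ z ≤ f₂ z := by
    filter_upwards [codiscreteWithin_mono (Set.subset_univ _) h,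
      self_mem_codiscreteWithin (Metric.sphere c |R|)] with z hz hz' using hz hz'
  unfold Real.circleAverage
  rw [smul_eq_mul, smul_eq_mul]
  refine mul_le_mul_of_nonneg_left ?_ (by positivity)
  refine intervalIntegral.integral_mono_ae_restrict Real.two_pi_pos.le h₁ h₂ ?_
  rw [← Set.uIcc_of_le Real.two_pi_pos.le]
  exact ae_restrict_le_codiscreteWithin measurableSet_uIcc
    (codiscreteWithin_mono (Set.subset_univ _) (circleMap_preimage_codiscrete hR h'))

theorem intervalIntegrable_inv_sqrt_abs_sin (a b : ℝ) :
    IntervalIntegrable (fun θ : ℝ => (√|Real.sin θ|)⁻¹) MeasureTheory.volume a b := by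
  have hper : Function.Periodic (fun θ : ℝ => (√|Real.sin θ|)⁻¹) Real.pi := fun θ => by
    simp [Real.sin_add_pi]
  refine hper.intervalIntegrable (t := 0) Real.pi_ne_zero ?_ a b
  rw [zero_add]
  have hmeas : Measurable fun θ : ℝ => (√|Real.sin θ|)⁻¹ := by fun_prop
  have hhalf : IntervalIntegrable (fun θ : ℝ => (√|Real.sin θ|)⁻¹) MeasureTheory.volume 0
      (Real.pi / 2) := by
    have h1 : IntervalIntegrable (fun θ : ℝ => (√(2 / Real.pi))⁻¹ * θ ^ (-(1 / 2) : ℝ))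
        MeasureTheory.volume 0 (Real.pi / 2) :=
      (intervalIntegral.intervalIntegrable_rpow' (by norm_num)).const_mul _
    refine h1.mono_fun' hmeas.aestronglyMeasurable ?_
    refine (MeasureTheory.ae_restrict_mem measurableSet_uIoc).mono fun θ hθ => ?_
    rw [Set.uIoc_of_le (by positivity)] at hθ
    have h2 := Real.mul_le_sin hθ.1.le hθ.2
    have h3 : 0 < 2 / Real.pi * θ := mul_pos (by positivity) hθ.1
    dsimp only
    rw [Real.norm_of_nonneg (by positivity), Real.rpow_neg hθ.1.le, ← Real.sqrt_eq_rpow,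
      ← mul_inv, ← Real.sqrt_mul (by positivity)]
    have h4 : 2 / Real.pi * θ ≤ |Real.sin θ| := h2.trans (le_abs_self _)
    have h5 : 0 < √(2 / Real.pi * θ) := Real.sqrt_pos.2 h3
    gcongr
  refine hhalf.trans ?_
  have h6 := hhalf.comp_sub_left Real.pi
  simp only [Real.sin_pi_sub, sub_zero] at h6
  convert h6.symm using 1
  ring

theorem abs_sin_sub_arg_le_norm_circleMap_sub {r : ℝ} (hr : 1 ≤ r) (a : ℂ) (θ : ℝ) :
    |Real.sin (θ - a.arg)| ≤ ‖circleMap 0 r θ - a‖ := by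
  have h1 : ((circleMap 0 r θ - a) * Complex.exp (-(a.arg * Complex.I))).im
      = r * Real.sin (θ - a.arg) := by
    have h2 : a * Complex.exp (-(a.arg * Complex.I)) = ‖a‖ := by
      nth_rw 1 [← Complex.norm_mul_exp_arg_mul_I a]
      rw [mul_assoc, ← Complex.exp_add, add_neg_cancel, Complex.exp_zero, mul_one]
    have h3 : circleMap 0 r θ * Complex.exp (-(a.arg * Complex.I))
        = r * Complex.exp (((θ - a.arg : ℝ) : ℂ) * Complex.I) := by
      rw [circleMap_zero, mul_assoc, ← Complex.exp_add]
      congr 2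
      push_cast
      ring
    rw [sub_mul, h2, h3, Complex.sub_im, Complex.im_ofReal_mul,
      Complex.exp_ofReal_mul_I_im, Complex.ofReal_im, sub_zero]
  have h4 := Complex.abs_im_le_norm ((circleMap 0 r θ - a) * Complex.exp (-(a.arg * Complex.I)))
  rw [h1, norm_mul, show -((a.arg : ℂ) * Complex.I) = ((-a.arg : ℝ) : ℂ) * Complex.I by
    push_cast; ring, Complex.norm_exp_ofReal_mul_I, mul_one, abs_mul] at h4
  refine le_trans ?_ h4
  rw [abs_of_pos (by linarith : 0 < r)]
  exact le_mul_of_one_le_left (abs_nonneg _) hr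

theorem exists_circleAverage_inv_sqrt_norm_sub_le : ∃ C : ℝ, 0 ≤ C ∧ ∀ r : ℝ, 1 ≤ r → ∀ a : ℂ,
    CircleIntegrable (fun z => (√‖z - a‖)⁻¹) 0 r ∧
      Real.circleAverage (fun z => (√‖z - a‖)⁻¹) 0 r ≤ C := by
  refine ⟨(2 * Real.pi)⁻¹ * ∫ θ in (0 : ℝ)..2 * Real.pi, (√|Real.sin θ|)⁻¹, ?_, ?_⟩
  · refine mul_nonneg (by positivity) ?_
    exact intervalIntegral.integral_nonneg Real.two_pi_pos.le fun θ _ => by positivity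
  intro r hr a
  have hsh : IntervalIntegrable (fun θ : ℝ => (√|Real.sin (θ - a.arg)|)⁻¹) MeasureTheory.volume 0
      (2 * Real.pi) := by
    have := (intervalIntegrable_inv_sqrt_abs_sin (0 - a.arg) (2 * Real.pi - a.arg)).comp_sub_right
      a.arg
    simpa using this
  have hae : ∀ᵐ θ : ℝ, (√‖circleMap 0 r θ - a‖)⁻¹ ≤ (√|Real.sin (θ - a.arg)|)⁻¹ := by
    have hc : {θ : ℝ | Real.sin (θ - a.arg) = 0}.Countable := by
      refine (Set.countable_range fun n : ℤ => n * Real.pi + a.arg).mono fun θ hθ => ?_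
      obtain ⟨n, hn⟩ := Real.sin_eq_zero_iff.1 hθ
      exact ⟨n, by simp [hn]⟩
    filter_upwards [hc.ae_notMem MeasureTheory.volume] with θ hθ
    have h1 : 0 < |Real.sin (θ - a.arg)| := abs_pos.2 hθ
    have h2 := Real.sqrt_pos.2 h1
    have h3 := abs_sin_sub_arg_le_norm_circleMap_sub hr a θ
    gcongr
  have hint : CircleIntegrable (fun z => (√‖z - a‖)⁻¹) 0 r := by
    refine hsh.mono_fun' (Measurable.aestronglyMeasurable ?_) ?_
    · have := (continuous_circleMap 0 r).measurable
      fun_prop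
    · refine MeasureTheory.ae_restrict_of_ae (hae.mono fun θ hθ => ?_)
      simpa only [norm_inv, Real.norm_of_nonneg (Real.sqrt_nonneg _)] using hθ
  refine ⟨hint, ?_⟩
  unfold Real.circleAverage
  rw [smul_eq_mul]
  refine mul_le_mul_of_nonneg_left ?_ (by positivity)
  refine (intervalIntegral.integral_mono_ae Real.two_pi_pos.le hint hsh hae).trans (le_of_eq ?_)
  rw [intervalIntegral.integral_comp_sub_right (fun θ : ℝ => (√|Real.sin θ|)⁻¹)]
  have hper : Function.Periodic (fun θ : ℝ => (√|Real.sin θ|)⁻¹) (2 * Real.pi) := fun θ => by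
    simp
  have := hper.intervalIntegral_add_eq (0 - a.arg) 0
  simp only [zero_add] at this
  rw [← this]
  congr 1
  ring

theorem circleAverage_multiset_sum_le {F : ℂ → ℂ → ℝ} {C r : ℝ}
    (h : ∀ a, CircleIntegrable (F a) 0 r ∧ Real.circleAverage (F a) 0 r ≤ C) (s : Multiset ℂ) :
    CircleIntegrable (fun z => (s.map fun a => F a z).sum) 0 r ∧
      Real.circleAverage (fun z => (s.map fun a => F a z).sum) 0 r ≤ Multiset.card s * C := by
  induction s using Multiset.induction_on with
  | empty => simp [Real.circleAverage_const]
  | cons a s ih =>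
    simp only [Multiset.map_cons, Multiset.sum_cons, Multiset.card_cons]
    refine ⟨(h a).1.add ih.1, ?_⟩
    have h1 := Real.circleAverage_fun_add (h a).1 ih.1
    rw [h1]
    push_cast
    linarith [(h a).2, ih.2]

theorem circleIntegrable_posLog_norm_logDeriv {f : ℂ → ℂ} (hf : Differentiable ℂ f) (r : ℝ) :
    CircleIntegrable (fun z => Real.posLog ‖logDeriv f z‖) 0 r := by
  refine MeromorphicOn.circleIntegrable_posLog_norm fun z _ => ?_
  exact (hf.analyticAt z).deriv.meromorphicAt.div (hf.analyticAt z).meromorphicAt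

theorem eventually_codiscrete_ne_zero {f : ℂ → ℂ} (hf : Differentiable ℂ f) {z₀ : ℂ}
    (h0 : f z₀ ≠ 0) : ∀ᶠ z in codiscrete ℂ, f z ≠ 0 :=
  AnalyticOnNhd.preimage_zero_mem_codiscrete (fun z _ => hf.analyticAt z) h0

/-- The lemma on the logarithmic derivative for entire functions of finite order. -/
theorem exists_circleAverage_posLog_logDeriv_le {f : ℂ → ℂ} (hf : Differentiable ℂ f) {z₀ : ℂ}
    (h0 : f z₀ ≠ 0) {A : ℝ} {m : ℕ} (hA : ∀ z, ‖f z‖ ≤ Real.exp (A * (1 + ‖z‖) ^ m)) :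
    ∃ K : ℝ, ∀ᶠ r : ℝ in atTop,
      Real.circleAverage (fun z => Real.posLog ‖logDeriv f z‖) 0 r ≤ K * Real.log r := by
  obtain ⟨C, hC, hCr⟩ := exists_circleAverage_inv_sqrt_norm_sub_le
  set L := |Real.log ‖f z₀‖| with hL
  set K₀ := |A| * 11 ^ m + L + 1 with hK₀
  have hL0 : 0 ≤ L := abs_nonneg _
  have hK₀0 : 0 < K₀ := by positivity
  set K₁ := 2 + 2 * C * K₀ + 60 * K₀ with hK₁
  refine ⟨2 * m + 2, ?_⟩
  filter_upwards [eventually_ge_atTop 1, eventually_ge_atTop ‖z₀‖, eventually_ge_atTop K₁]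
    with r hr1 hrz hrK
  set B := K₀ * r ^ m with hB
  have hrm : 1 ≤ r ^ m := one_le_pow₀ hr1
  have hB0 : 0 < B := by positivity
  obtain ⟨s, hs, hsz⟩ := exists_norm_logDeriv_le hf h0 (ρ := 3 * r) (B := B) (by positivity) hB0 (by
    intro z hz
    refine (hA z).trans ?_
    rw [← Real.exp_log (norm_pos_iff.2 h0), ← Real.exp_add]
    refine Real.exp_le_exp.2 ?_
    rw [mem_closedBall_iff_norm] at hz
    have h1 : 1 + ‖z‖ ≤ 11 * r := by
      have := norm_le_norm_sub_add z z₀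
      linarith
    have h2 : A * (1 + ‖z‖) ^ m ≤ |A| * (11 * r) ^ m := by
      calc A * (1 + ‖z‖) ^ m ≤ |A| * (1 + ‖z‖) ^ m := by gcongr; exact le_abs_self A
        _ ≤ _ := by gcongr
    have h3 : -L ≤ Real.log ‖f z₀‖ := neg_abs_le _
    rw [mul_pow] at h2
    have h4 : L ≤ L * r ^ m := le_mul_of_one_le_right hL0 hrm
    rw [hB, hK₀]
    nlinarith)
  set D := 1 + 2 * B * C + √(60 * B / (3 * r)) with hD
  have hD1 : 1 ≤ D := by
    have : 0 ≤ 2 * B * C := by positivity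
    have := Real.sqrt_nonneg (60 * B / (3 * r))
    linarith
  have hD0 : 0 < D := by linarith
  set X : ℂ → ℝ := fun z => (s.map fun a => (√‖z - a‖)⁻¹).sum with hX
  obtain ⟨hXi, hXa⟩ := circleAverage_multiset_sum_le (F := fun a z => (√‖z - a‖)⁻¹) (hCr r hr1) s
  have hpt : ∀ᶠ z in codiscrete ℂ, z ∈ Metric.sphere (0 : ℂ) |r| →
      Real.posLog ‖logDeriv f z‖
        ≤ 2 * (Real.log D + ((1 + √(60 * B / (3 * r))) / D - 1)) + 2 / D * X z := by
    filter_upwards [eventually_codiscrete_ne_zero hf h0] with z hz hzr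
    rw [mem_sphere_zero_iff_norm, abs_of_pos (by linarith)] at hzr
    have h1 := hsz z (by
      have := norm_sub_le z z₀
      linarith) hz
    have hX0 : 0 ≤ (s.map fun a => ‖z - a‖⁻¹).sum := Multiset.sum_nonneg (by
      simp only [Multiset.mem_map]
      rintro _ ⟨a, -, rfl⟩
      positivity)
    have hX1 : 0 ≤ X z := Multiset.sum_nonneg (by
      simp only [Multiset.mem_map]
      rintro _ ⟨a, -, rfl⟩
      positivity)
    have h2 := sqrt_add_le_add_sqrt (s.map fun a => ‖z - a‖⁻¹).sum
      (by positivity : 0 ≤ 60 * B / (3 * r))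
    have h3 := sqrt_multiset_sum_inv_le s z
    have h4 := posLog_le_two_mul_log_one_add_sqrt (norm_nonneg (logDeriv f z))
    have h5 := Real.sqrt_le_sqrt h1
    have h6 : Real.log (1 + √‖logDeriv f z‖) ≤ Real.log (1 + √(60 * B / (3 * r)) + X z) :=
      Real.log_le_log (by positivity) (by linarith)
    have h7 := log_le_log_add_div_sub_one (x := 1 + √(60 * B / (3 * r)) + X z) (by positivity) hD0
    rw [add_div] at h7
    calc _ ≤ 2 * (Real.log D + ((1 + √(60 * B / (3 * r))) / D + X z / D - 1)) := by linarith
      _ = _ := by ring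
  have hr0 : r ≠ 0 := by linarith
  have hXi' : CircleIntegrable (fun z => 2 / D * X z) 0 r := hXi.const_mul (2 / D)
  have havg := circleAverage_mono_codiscrete hr0 (circleIntegrable_posLog_norm_logDeriv hf r)
    ((circleIntegrable_const _ 0 r).add hXi') hpt
  have hsm : Real.circleAverage (fun z => 2 / D * X z) 0 r = 2 / D * Real.circleAverage X 0 r :=
    Real.circleAverage_fun_smul (a := 2 / D) (f := X)
  rw [Real.circleAverage_add (circleIntegrable_const _ 0 r) hXi',
    Real.circleAverage_const, hsm] at havg
  have hfin : Real.circleAverage (fun z => Real.posLog ‖logDeriv f z‖) 0 r ≤ 2 * Real.log D := by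
    refine havg.trans ?_
    have h1 : Real.circleAverage X 0 r ≤ 2 * B * C := hXa.trans (by gcongr)
    have h2 : 2 / D * Real.circleAverage X 0 r ≤ 2 / D * (2 * B * C) := by gcongr
    have h3 : (1 + √(60 * B / (3 * r))) / D + 2 * B * C / D = 1 := by
      rw [← add_div, div_eq_one_iff_eq hD0.ne', hD]
      ring
    have h4 : 2 / D * (2 * B * C) = 2 * (2 * B * C / D) := by ring
    linarith
  refine hfin.trans ?_
  have hDle : D ≤ K₁ * r ^ m := by
    have h1 : √(60 * B / (3 * r)) ≤ 1 + 60 * B := by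
      rw [Real.sqrt_le_left (by positivity)]
      have : 60 * B / (3 * r) ≤ 60 * B := div_le_self (by positivity) (by linarith)
      nlinarith
    rw [hD, hK₁]
    have : B = K₀ * r ^ m := rfl
    nlinarith
  have hr0' : 0 < r := by linarith
  have hK₁0 : 0 < K₁ := by positivity
  have h1 : Real.log D ≤ Real.log K₁ + m * Real.log r := by
    rw [← Real.log_pow, ← Real.log_mul hK₁0.ne' (by positivity)]
    exact Real.log_le_log hD0 hDle
  have h2 : Real.log K₁ ≤ Real.log r := Real.log_le_log hK₁0 hrK
  linarith

theorem norm_eval_le_sum_coeff_mul {p : ℂ[X]} {N : ℕ} (hp : p.natDegree ≤ N) (z : ℂ) :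
    ‖p.eval z‖ ≤ (∑ i ∈ Finset.range (N + 1), ‖p.coeff i‖) * (1 + ‖z‖) ^ N := by
  rw [eval_eq_sum_range' (Nat.lt_succ_of_le hp), Finset.sum_mul]
  refine (norm_sum_le _ _).trans (Finset.sum_le_sum fun i hi => ?_)
  rw [norm_mul, norm_pow]
  gcongr
  have h1 : i ≤ N := Nat.lt_succ_iff.1 (Finset.mem_range.1 hi)
  have h0 := norm_nonneg z
  calc ‖z‖ ^ i ≤ (1 + ‖z‖) ^ i := by gcongr; linarith
    _ ≤ (1 + ‖z‖) ^ N := pow_le_pow_right₀ (by linarith) h1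

/-- A common polynomial bound for finitely many polynomials. -/
theorem exists_forall_norm_eval_le {ι : Type*} (s : Finset ι) (p : ι → ℂ[X]) {N : ℕ}
    (hp : ∀ j ∈ s, (p j).natDegree ≤ N) :
    ∃ C : ℝ, 1 ≤ C ∧ ∀ j ∈ s, ∀ z, ‖(p j).eval z‖ ≤ C * (1 + ‖z‖) ^ N := by
  refine ⟨1 + ∑ j ∈ s, ∑ i ∈ Finset.range (N + 1), ‖(p j).coeff i‖, ?_, fun j hj z => ?_⟩
  · have : 0 ≤ ∑ j ∈ s, ∑ i ∈ Finset.range (N + 1), ‖(p j).coeff i‖ := by positivity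
    linarith
  · refine (norm_eval_le_sum_coeff_mul (hp j hj) z).trans ?_
    gcongr
    have := Finset.single_le_sum (f := fun j => ∑ i ∈ Finset.range (N + 1), ‖(p j).coeff i‖)
      (fun _ _ => by positivity) hj
    linarith

theorem exists_pos_le_norm_eval {p : ℂ[X]} (hp : p ≠ 0) :
    ∃ c R : ℝ, 0 < c ∧ ∀ z, R ≤ ‖z‖ → c ≤ ‖p.eval z‖ := by
  rcases Nat.eq_zero_or_pos p.natDegree with h | h
  · rw [eq_C_of_natDegree_eq_zero h] at hp ⊢
    exact ⟨‖p.coeff 0‖, 0, norm_pos_iff.2 (by simpa using hp), fun z _ => by simp⟩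
  · have h1 : Tendsto (fun z : ℂ => ‖p.eval z‖) (Bornology.cobounded ℂ) atTop :=
      p.tendsto_norm_atTop (natDegree_pos_iff_degree_pos.1 h) tendsto_norm_cobounded_atTop
    have h2 := h1.eventually_ge_atTop 1
    rw [← comap_norm_atTop, eventually_comap] at h2
    obtain ⟨R, hR⟩ := eventually_atTop.1 h2
    exact ⟨1, R, one_pos, fun z hz => hR ‖z‖ hz z rfl⟩

/-- The sum `∑ j ∈ s, P j * exp (Q j)`. -/
noncomputable def expSum {ι : Type*} (s : Finset ι) (P Q : ι → ℂ[X]) (z : ℂ) : ℂ :=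
  ∑ j ∈ s, (P j).eval z * Complex.exp ((Q j).eval z)

theorem hasDerivAt_expSum {ι : Type*} (s : Finset ι) (P Q : ι → ℂ[X]) (z : ℂ) :
    HasDerivAt (expSum s P Q)
      (expSum s (fun j => derivative (P j) + P j * derivative (Q j)) Q z) z := by
  unfold expSum
  refine HasDerivAt.fun_sum fun j _ => ?_
  convert! ((P j).hasDerivAt z).mul ((Q j).hasDerivAt z).cexp using 1
  simp only [eval_add, eval_mul]
  ring

theorem differentiable_expSum {ι : Type*} (s : Finset ι) (P Q : ι → ℂ[X]) :
    Differentiable ℂ (expSum s P Q) := fun z => (hasDerivAt_expSum s P Q z).differentiableAt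

theorem exists_norm_expSum_le {ι : Type*} (s : Finset ι) (P Q : ι → ℂ[X]) :
    ∃ (A : ℝ) (m : ℕ), ∀ z, ‖expSum s P Q z‖ ≤ Real.exp (A * (1 + ‖z‖) ^ m) := by
  set N := s.sup (fun j => (P j).natDegree) + s.sup (fun j => (Q j).natDegree) with hN
  obtain ⟨C, hC, hP⟩ := exists_forall_norm_eval_le s P (N := N) fun j hj =>
    le_add_of_le_left (Finset.le_sup (f := fun j => (P j).natDegree) hj)
  obtain ⟨C', hC', hQ⟩ := exists_forall_norm_eval_le s Q (N := N) fun j hj =>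
    le_add_of_le_right (Finset.le_sup (f := fun j => (Q j).natDegree) hj)
  refine ⟨s.card + C + C', N, fun z => ?_⟩
  have h0 := norm_nonneg z
  have hu : 1 ≤ (1 + ‖z‖) ^ N := one_le_pow₀ (by linarith)
  set u := (1 + ‖z‖) ^ N with hudef
  have hexp : ∀ x : ℝ, x ≤ Real.exp x := fun x => by linarith [Real.add_one_le_exp x]
  calc ‖expSum s P Q z‖ ≤ ∑ j ∈ s, ‖(P j).eval z * Complex.exp ((Q j).eval z)‖ := norm_sum_le _ _
    _ ≤ ∑ j ∈ s, Real.exp (C * u) * Real.exp (C' * u) := by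
        refine Finset.sum_le_sum fun j hj => ?_
        rw [norm_mul, Complex.norm_exp]
        gcongr
        · exact (hP j hj z).trans (hexp _)
        · exact (Complex.re_le_norm _).trans (hQ j hj z)
    _ = s.card * (Real.exp (C * u) * Real.exp (C' * u)) := by rw [Finset.sum_const, nsmul_eq_mul]
    _ ≤ Real.exp (s.card * u) * (Real.exp (C * u) * Real.exp (C' * u)) := by
        gcongr
        refine le_trans ?_ (hexp _)
        exact le_mul_of_one_le_right (by positivity) hu
    _ = _ := by
        rw [← Real.exp_add, ← Real.exp_add]
        ring_nf

/-- The coefficients of `P k * f' - (P k' + P k * Q k') * f` when `f = ∑ P j * exp (Q j)`. -/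
noncomputable def eliminate {ι : Type*} (P Q : ι → ℂ[X]) (k : ι) (j : ι) : ℂ[X] :=
  P k * derivative (P j) - derivative (P k) * P j +
    P k * P j * (derivative (Q j) - derivative (Q k))

theorem eliminate_self {ι : Type*} (P Q : ι → ℂ[X]) (k : ι) : eliminate P Q k k = 0 := by
  simp [eliminate, mul_comm]

theorem eliminate_ne_zero {ι : Type*} {P Q : ι → ℂ[X]} {k j : ι} (hk : P k ≠ 0) (hj : P j ≠ 0)
    (hQ : derivative (Q j) ≠ derivative (Q k)) : eliminate P Q k j ≠ 0 := by
  intro h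
  rw [eliminate] at h
  have hD : derivative (Q j) - derivative (Q k) ≠ 0 := sub_ne_zero.2 hQ
  have h1 : degree (P k * derivative (P j) - derivative (P k) * P j) < degree (P k * P j) := by
    refine (degree_sub_le _ _).trans_lt (max_lt ?_ ?_)
    · rw [degree_mul, degree_mul]
      exact WithBot.add_lt_add_left (degree_ne_bot.2 hk) (degree_derivative_lt hj)
    · rw [degree_mul, degree_mul]
      exact WithBot.add_lt_add_right (degree_ne_bot.2 hj) (degree_derivative_lt hk)
  have h2 : degree (P k * P j) ≤ degree (P k * P j * (derivative (Q j) - derivative (Q k))) :=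
    degree_le_mul_left _ hD
  rw [eq_neg_of_add_eq_zero_left h, degree_neg] at h1
  exact absurd h1 (not_lt.2 h2)

theorem expSum_erase_eliminate {ι : Type*} [DecidableEq ι] (s : Finset ι) (P Q : ι → ℂ[X]) (k : ι)
    (z : ℂ) : expSum (s.erase k) (eliminate P Q k) Q z =
      (P k).eval z * deriv (expSum s P Q) z -
        (derivative (P k) + P k * derivative (Q k)).eval z * expSum s P Q z := by
  rw [(hasDerivAt_expSum s P Q z).deriv]
  have h1 : expSum (s.erase k) (eliminate P Q k) Q z = expSum s (eliminate P Q k) Q z := by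
    unfold expSum
    by_cases hk : k ∈ s
    · rw [← Finset.add_sum_erase s _ hk, eliminate_self]
      simp
    · rw [Finset.erase_eq_of_notMem hk]
  rw [h1]
  unfold expSum
  rw [Finset.mul_sum, Finset.mul_sum, ← Finset.sum_sub_distrib]
  refine Finset.sum_congr rfl fun j _ => ?_
  simp only [eliminate, eval_add, eval_sub, eval_mul]
  ring

theorem eventually_log_const_mul_pow_le (C : ℝ) (hC : 0 < C) (N : ℕ) :
    ∀ᶠ r : ℝ in atTop, Real.log (C * (1 + r) ^ N) ≤ (1 + 2 * N) * Real.log r := by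
  filter_upwards [eventually_ge_atTop 2, eventually_ge_atTop C] with r hr hrC
  rw [Real.log_mul hC.ne' (by positivity), Real.log_pow]
  have h1 : Real.log C ≤ Real.log r := Real.log_le_log hC hrC
  have h2 : Real.log (1 + r) ≤ 2 * Real.log r := by
    rw [show (2 : ℝ) * Real.log r = Real.log (r ^ 2) by rw [Real.log_pow]; norm_num]
    exact Real.log_le_log (by linarith) (by nlinarith)
  nlinarith [(Nat.cast_nonneg N : (0 : ℝ) ≤ N)]

theorem circleAverage_comp_norm (φ : ℝ → ℝ) {r : ℝ} (hr : 0 ≤ r) :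
    Real.circleAverage (fun z => φ ‖z‖) 0 r = φ r :=
  Real.circleAverage_const_on_circle fun z hz => by
    rw [mem_sphere_zero_iff_norm, abs_of_nonneg hr] at hz
    rw [hz]

/-- Off a discrete set, each exponential of an exponential sum is dominated by the sum, up to an
error term with logarithmic circle averages. In particular the sum does not vanish identically. -/
theorem exists_re_eval_le_log_norm_expSum {ι : Type*} [DecidableEq ι] (Q : ι → ℂ[X]) (n : ℕ) :
    ∀ s : Finset ι, s.card = n + 1 →
      (∀ i ∈ s, ∀ j ∈ s, i ≠ j → derivative (Q i) ≠ derivative (Q j)) →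
      ∀ P : ι → ℂ[X], (∀ j ∈ s, P j ≠ 0) → (∃ z, expSum s P Q z ≠ 0) ∧
        ∀ j ∈ s, ∃ (E : ℂ → ℝ) (R K : ℝ), (∀ z, 0 ≤ E z) ∧ (∀ r, CircleIntegrable E 0 r) ∧
          (∀ᶠ r : ℝ in atTop, Real.circleAverage E 0 r ≤ K * Real.log r) ∧
          ∀ᶠ z in codiscrete ℂ, R ≤ ‖z‖ → ((Q j).eval z).re ≤ Real.log ‖expSum s P Q z‖ + E z := by
  induction n with
  | zero =>
    intro s hs _ P hP
    obtain ⟨j, rfl⟩ := Finset.card_eq_one.1 hs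
    obtain ⟨c, R, hc, hcR⟩ := exists_pos_le_norm_eval (hP j (by simp))
    have hval : ∀ z, R ≤ ‖z‖ → 0 < ‖(P j).eval z‖ := fun z hz => hc.trans_le (hcR z hz)
    refine ⟨⟨(|R| : ℝ), ?_⟩, fun i hi => ?_⟩
    · have h1 := hval (|R| : ℝ) (by simp [le_abs_self])
      simp only [expSum, Finset.sum_singleton]
      exact mul_ne_zero (norm_pos_iff.1 h1) (Complex.exp_ne_zero _)
    · obtain rfl := Finset.mem_singleton.1 hi
      refine ⟨fun _ => |Real.log c|, R, 1, fun _ => abs_nonneg _,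
        fun r => circleIntegrable_const _ _ _, ?_, Eventually.of_forall fun z hz => ?_⟩
      · filter_upwards [Real.tendsto_log_atTop.eventually_ge_atTop |Real.log c|] with r hr
        rw [Real.circleAverage_const, one_mul]
        exact hr
      · simp only [expSum, Finset.sum_singleton]
        rw [norm_mul, Complex.norm_exp, Real.log_mul (hval z hz).ne' (Real.exp_ne_zero _),
          Real.log_exp]
        have h1 := Real.log_le_log hc (hcR z hz)
        have h2 := neg_abs_le (Real.log c)
        linarith
  | succ n ih =>
    intro s hs hQ P hP
    have step : ∀ k ∈ s, (∃ z, expSum (s.erase k) (eliminate P Q k) Q z ≠ 0) ∧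
        ∀ j ∈ s.erase k, ∃ (E : ℂ → ℝ) (R K : ℝ), (∀ z, 0 ≤ E z) ∧ (∀ r, CircleIntegrable E 0 r) ∧
          (∀ᶠ r : ℝ in atTop, Real.circleAverage E 0 r ≤ K * Real.log r) ∧
          ∀ᶠ z in codiscrete ℂ, R ≤ ‖z‖ → ((Q j).eval z).re ≤
            Real.log ‖expSum (s.erase k) (eliminate P Q k) Q z‖ + E z := by
      intro k hk
      refine ih (s.erase k) (by rw [Finset.card_erase_of_mem hk, hs]; rfl) ?_ _ ?_
      · exact fun i hi j hj => hQ i (Finset.mem_of_mem_erase hi) j (Finset.mem_of_mem_erase hj)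
      · intro j hj
        have hj' := Finset.mem_of_mem_erase hj
        exact eliminate_ne_zero (hP k hk) (hP j hj') (hQ j hj' k hk (Finset.ne_of_mem_erase hj))
    have hne : ∃ z, expSum s P Q z ≠ 0 := by
      by_contra! h0
      obtain ⟨k, hk⟩ := Finset.card_pos.1 (by rw [hs]; exact Nat.succ_pos _)
      obtain ⟨z, hz⟩ := (step k hk).1
      refine hz ?_
      rw [expSum_erase_eliminate, h0 z, show expSum s P Q = fun _ => 0 from funext h0]
      simp
    refine ⟨hne, fun j hj => ?_⟩
    obtain ⟨k, hk, hkj⟩ := Finset.exists_mem_ne (by rw [hs]; omega) j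
    obtain ⟨⟨z₁, hz₁⟩, hstep⟩ := step k hk
    obtain ⟨E, R, K, hE0, hEi, hEa, hE⟩ := hstep j (Finset.mem_erase.2 ⟨hkj.symm, hj⟩)
    obtain ⟨z₀, hz₀⟩ := hne
    set f := expSum s P Q with hf
    have hfd : Differentiable ℂ f := differentiable_expSum s P Q
    obtain ⟨A, m, hA⟩ := exists_norm_expSum_le s P Q
    obtain ⟨K', hK'⟩ := exists_circleAverage_posLog_logDeriv_le hfd hz₀ hA
    set T := derivative (P k) + P k * derivative (Q k) with hT
    set N := (P k).natDegree + T.natDegree with hN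
    obtain ⟨C₁, hC₁, hb₁⟩ := exists_forall_norm_eval_le {()} (fun _ => P k) (N := N)
      (fun _ _ => Nat.le_add_right _ _)
    obtain ⟨C₂, hC₂, hb₂⟩ := exists_forall_norm_eval_le {()} (fun _ => T) (N := N)
      (fun _ _ => Nat.le_add_left _ _)
    have hlogi : ∀ r, CircleIntegrable (fun z : ℂ => Real.log ((C₁ + C₂) * (1 + ‖z‖) ^ N)) 0 r := by
      intro r
      refine ContinuousOn.circleIntegrable' (Continuous.continuousOn ?_)
      refine Continuous.log (by fun_prop) fun z => ?_
      have := norm_nonneg z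
      positivity
    have hposi := circleIntegrable_posLog_norm_logDeriv hfd
    refine ⟨fun z => E z + Real.posLog ‖logDeriv f z‖ + Real.log ((C₁ + C₂) * (1 + ‖z‖) ^ N),
      R, K + K' + (1 + 2 * N), fun z => ?_, fun r => ((hEi r).add (hposi r)).add (hlogi r), ?_, ?_⟩
    · have h1 : 1 ≤ (1 + ‖z‖) ^ N := one_le_pow₀ (by linarith [norm_nonneg z])
      have h2 : 0 ≤ Real.log ((C₁ + C₂) * (1 + ‖z‖) ^ N) := Real.log_nonneg (by nlinarith)
      have h3 := hE0 z
      have h4 : 0 ≤ Real.posLog ‖logDeriv f z‖ := Real.posLog_nonneg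
      linarith
    · filter_upwards [hEa, hK', eventually_log_const_mul_pow_le (C₁ + C₂) (by linarith) N,
        eventually_ge_atTop 0] with r h1 h2 h3 hr
      have hadd : CircleIntegrable (fun z => E z + Real.posLog ‖logDeriv f z‖) 0 r :=
        (hEi r).add (hposi r)
      rw [Real.circleAverage_fun_add hadd (hlogi r),
        Real.circleAverage_fun_add (hEi r) (hposi r),
        circleAverage_comp_norm (fun x => Real.log ((C₁ + C₂) * (1 + x) ^ N)) hr]
      linarith
    · filter_upwards [hE, eventually_codiscrete_ne_zero hfd hz₀,
        eventually_codiscrete_ne_zero (differentiable_expSum _ _ _) hz₁] with z h1 h2 h3 hz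
      refine (h1 hz).trans ?_
      have h4 : expSum (s.erase k) (eliminate P Q k) Q z
          = f z * ((P k).eval z * logDeriv f z - T.eval z) := by
        rw [expSum_erase_eliminate, logDeriv_apply, ← hf, ← hT]
        field_simp
      have h5 : (P k).eval z * logDeriv f z - T.eval z ≠ 0 := by
        intro h
        rw [h4, h, mul_zero] at h3
        exact h3 rfl
      rw [h4, norm_mul, Real.log_mul (norm_ne_zero_iff.2 h2) (norm_ne_zero_iff.2 h5)]
      have h6 : ‖(P k).eval z * logDeriv f z - T.eval z‖
          ≤ (C₁ + C₂) * (1 + ‖z‖) ^ N * max 1 ‖logDeriv f z‖ := by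
        have e1 := hb₁ () (by simp) z
        have e2 := hb₂ () (by simp) z
        have e3 := le_max_left 1 ‖logDeriv f z‖
        have e4 := le_max_right 1 ‖logDeriv f z‖
        have e5 : 0 ≤ C₂ * (1 + ‖z‖) ^ N := (norm_nonneg _).trans e2
        calc _ ≤ ‖(P k).eval z‖ * ‖logDeriv f z‖ + ‖T.eval z‖ := by
              refine (norm_sub_le _ _).trans ?_
              rw [norm_mul]
          _ ≤ C₁ * (1 + ‖z‖) ^ N * max 1 ‖logDeriv f z‖ +
              C₂ * (1 + ‖z‖) ^ N * max 1 ‖logDeriv f z‖ := by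
              gcongr
              exact e2.trans (le_mul_of_one_le_right e5 e3)
          _ = _ := by ring
      have h7 := Real.log_le_log (norm_pos_iff.2 h5) h6
      have h8 : 0 < (C₁ + C₂) * (1 + ‖z‖) ^ N := by
        have := norm_nonneg z
        positivity
      rw [Real.log_mul h8.ne' (by positivity), ← Real.posLog_eq_log_max_one (norm_nonneg _)] at h7
      linarith

theorem derivative_ne_of_eval_zero {p q : ℂ[X]} (hpq : p ≠ q) (hp : p.eval 0 = 0)
    (hq : q.eval 0 = 0) : derivative p ≠ derivative q := by
  intro h
  refine hpq (sub_eq_zero.1 ?_)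
  have h1 : (p - q).natDegree = 0 :=
    derivative_eq_zero.1 (by rw [derivative_sub, h, sub_self])
  rw [eq_C_of_natDegree_eq_zero h1, coeff_zero_eq_eval_zero, eval_sub, hp, hq]
  simp

/-- The growth of `max |exp (Q j z)|` to leading order: `max Re (w j * z ^ q)`. -/
noncomputable def leadingHeight {n : ℕ} (w : Fin (n + 1) → ℂ) (q : ℕ) (z : ℂ) : ℝ :=
  Finset.univ.sup' Finset.univ_nonempty fun j => (w j * z ^ q).re

theorem continuous_leadingHeight {n : ℕ} (w : Fin (n + 1) → ℂ) (q : ℕ) :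
    Continuous (leadingHeight w q) := by
  unfold leadingHeight
  exact Continuous.finset_sup'_apply _ fun j _ => by fun_prop

theorem natDegree_sub_leading_le {p : ℂ[X]} {q : ℕ} (hp : p.natDegree ≤ q) :
    (p - C (p.coeff q) * X ^ q).natDegree ≤ q - 1 := by
  rw [natDegree_le_iff_coeff_eq_zero]
  intro N hN
  rw [coeff_sub, coeff_C_mul, coeff_X_pow]
  split_ifs with h
  · simp [h]
  · rw [coeff_eq_zero_of_natDegree_lt (by omega)]
    simp

theorem isLittleO_error_term (C K : ℝ) {q : ℕ} (hq : 1 ≤ q) :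
    (fun r : ℝ => C * (1 + r) ^ (q - 1) + K * Real.log r) =o[atTop] fun r : ℝ => r ^ q := by
  have h1 : (fun r : ℝ => (1 + r) ^ (q - 1)) =O[atTop] fun r : ℝ => r ^ (q - 1) := by
    refine Asymptotics.IsBigO.pow ?_ _
    refine Asymptotics.IsBigO.of_bound 2 ?_
    filter_upwards [eventually_ge_atTop 1] with r hr
    rw [Real.norm_of_nonneg (by linarith), Real.norm_of_nonneg (by linarith)]
    linarith
  have h2 : (fun r : ℝ => r ^ (q - 1)) =o[atTop] fun r : ℝ => r ^ q :=
    Asymptotics.isLittleO_pow_pow_atTop_of_lt (by omega)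
  have h3 : (fun r : ℝ => Real.log r) =o[atTop] fun r : ℝ => r ^ q := by
    refine Real.isLittleO_log_id_atTop.trans_isBigO ?_
    refine Asymptotics.IsBigO.of_bound 1 ?_
    filter_upwards [eventually_ge_atTop 1] with r hr
    rw [id, Real.norm_of_nonneg (by linarith), Real.norm_of_nonneg (by positivity), one_mul]
    exact le_self_pow₀ hr (by omega)
  exact ((h1.trans_isLittleO h2).const_mul_left C).add (h3.const_mul_left K)

theorem circleIntegrable_log_norm {f : ℂ → ℂ} (hf : Differentiable ℂ f) (r : ℝ) :
    CircleIntegrable (fun z => Real.log ‖f z‖) 0 r :=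
  MeromorphicOn.circleIntegrable_log_norm fun z _ => (hf.analyticAt z).meromorphicAt

/-- To leading order, the circle averages of `log |f|` for an exponential polynomial `f` are those
of `max Re (w j * z ^ q)`. -/
theorem circleAverage_log_norm_expSum_sub_isLittleO {n : ℕ} (P Q : Fin (n + 1) → ℂ[X])
    (hP : ∀ j, P j ≠ 0) (hQ : Function.Injective Q) (hQ0 : ∀ j, (Q j).eval 0 = 0) {q : ℕ}
    (hq : 1 ≤ q) (hdeg : ∀ j, (Q j).natDegree ≤ q) :
    (∃ z, expSum Finset.univ P Q z ≠ 0) ∧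
      (fun r : ℝ => Real.circleAverage (fun z => Real.log ‖expSum Finset.univ P Q z‖) 0 r
        - Real.circleAverage (leadingHeight (fun j => (Q j).coeff q) q) 0 r)
        =o[atTop] fun r : ℝ => r ^ q := by
  obtain ⟨⟨z₀, hz₀⟩, hlow⟩ := exists_re_eval_le_log_norm_expSum Q n Finset.univ (by simp)
    (fun i _ j _ hij => derivative_ne_of_eval_zero (hQ.ne hij) (hQ0 i) (hQ0 j)) P fun j _ => hP j
  refine ⟨⟨z₀, hz₀⟩, ?_⟩
  set f := expSum Finset.univ P Q with hf
  set h := leadingHeight (fun j => (Q j).coeff q) q with hh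
  have hfd : Differentiable ℂ f := differentiable_expSum _ P Q
  have hfi := circleIntegrable_log_norm hfd
  have hhi : ∀ r, CircleIntegrable h 0 r := fun r =>
    (continuous_leadingHeight _ q).continuousOn.circleIntegrable'
  choose E R K hE0 hEi hEa hE using fun j => hlow j (Finset.mem_univ j)
  obtain ⟨C, hC, hCb⟩ := exists_forall_norm_eval_le Finset.univ
    (fun j => Q j - Polynomial.C ((Q j).coeff q) * X ^ q) (N := q - 1)
    fun j _ => natDegree_sub_leading_le (hdeg j)
  obtain ⟨D, hD, hDb⟩ := exists_forall_norm_eval_le Finset.univ P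
    (N := Finset.univ.sup fun j => (P j).natDegree) fun j hj =>
      Finset.le_sup (f := fun j => (P j).natDegree) hj
  set N := Finset.univ.sup fun j => (P j).natDegree with hN
  have hCb' : ∀ j z, |((Q j).eval z).re - ((Q j).coeff q * z ^ q).re|
      ≤ C * (1 + ‖z‖) ^ (q - 1) := by
    intro j z
    have h1 := (Complex.abs_re_le_norm _).trans (hCb j (Finset.mem_univ j) z)
    rw [eval_sub, Complex.sub_re, eval_C_mul, eval_pow, eval_X] at h1
    exact h1
  have hupper : ∀ᶠ z in codiscrete ℂ, Real.log ‖f z‖ ≤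
      h z + (C * (1 + ‖z‖) ^ (q - 1) + Real.log ((n + 1) * D * (1 + ‖z‖) ^ N)) := by
    filter_upwards [eventually_codiscrete_ne_zero hfd hz₀] with z hz
    have h0 := norm_nonneg z
    have hbound : ‖f z‖ ≤ (n + 1) * D * (1 + ‖z‖) ^ N *
        Real.exp (h z + C * (1 + ‖z‖) ^ (q - 1)) := by
      refine (norm_sum_le _ _).trans ?_
      calc ∑ j, ‖(P j).eval z * Complex.exp ((Q j).eval z)‖
          ≤ ∑ j : Fin (n + 1), D * (1 + ‖z‖) ^ N * Real.exp (h z + C * (1 + ‖z‖) ^ (q - 1)) := by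
            refine Finset.sum_le_sum fun j _ => ?_
            rw [norm_mul, Complex.norm_exp]
            gcongr
            · exact hDb j (Finset.mem_univ j) z
            · have h1 := (abs_le.1 (hCb' j z)).2
              have h2 : ((Q j).coeff q * z ^ q).re ≤ h z :=
                Finset.le_sup' (fun j => ((Q j).coeff q * z ^ q).re) (Finset.mem_univ j)
              linarith
        _ = _ := by
            rw [Finset.sum_const, Finset.card_univ, Fintype.card_fin, nsmul_eq_mul]
            push_cast
            ring
    have h1 := Real.log_le_log (norm_pos_iff.2 hz) hbound
    rw [Real.log_mul (by positivity) (Real.exp_ne_zero _), Real.log_exp] at h1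
    linarith
  have hlower : ∀ᶠ z in codiscrete ℂ, (∀ j, R j ≤ ‖z‖) →
      h z ≤ Real.log ‖f z‖ + (C * (1 + ‖z‖) ^ (q - 1) + ∑ j, E j z) := by
    filter_upwards [eventually_all.2 hE] with z hz hR
    refine Finset.sup'_le _ _ fun j _ => ?_
    have h1 := hz j (hR j)
    have h2 := (abs_le.1 (hCb' j z)).1
    have h3 : E j z ≤ ∑ j, E j z :=
      Finset.single_le_sum (f := fun j => E j z) (fun i _ => hE0 i z) (Finset.mem_univ j)
    linarith
  have hpow : ∀ r, CircleIntegrable (fun z : ℂ => C * (1 + ‖z‖) ^ (q - 1)) 0 r := fun r =>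
    ContinuousOn.circleIntegrable' (Continuous.continuousOn (by fun_prop))
  have hlog : ∀ r, CircleIntegrable
      (fun z : ℂ => Real.log ((n + 1) * D * (1 + ‖z‖) ^ N)) 0 r := by
    intro r
    refine ContinuousOn.circleIntegrable' (Continuous.continuousOn ?_)
    refine Continuous.log (by fun_prop) fun z => ?_
    have := norm_nonneg z
    positivity
  have hsum : ∀ r, CircleIntegrable (fun z => ∑ j, E j z) 0 r := fun r =>
    CircleIntegrable.fun_sum _ fun j _ => hEi j r
  have hup2 : ∀ r, CircleIntegrable (fun z : ℂ =>
      C * (1 + ‖z‖) ^ (q - 1) + Real.log ((n + 1) * D * (1 + ‖z‖) ^ N)) 0 r := fun r =>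
    (hpow r).add (hlog r)
  have hlow2 : ∀ r, CircleIntegrable (fun z : ℂ =>
      C * (1 + ‖z‖) ^ (q - 1) + ∑ j, E j z) 0 r := fun r => (hpow r).add (hsum r)
  refine Asymptotics.IsBigO.trans_isLittleO ?_
    (isLittleO_error_term C ((1 + 2 * N) + ∑ j, |K j|) hq)
  refine Asymptotics.IsBigO.of_bound 1 ?_
  filter_upwards [eventually_all.2 hEa, eventually_ge_atTop 1,
    eventually_all.2 fun j => eventually_ge_atTop (R j),
    eventually_log_const_mul_pow_le ((n + 1) * D) (by positivity) N] with r hr1 hr hrR hr2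
  have hr0 : r ≠ 0 := by linarith
  have hlogr : 0 ≤ Real.log r := Real.log_nonneg hr
  have hA := circleAverage_mono_codiscrete hr0 (hfi r) ((hhi r).add (hup2 r))
    (hupper.mono fun z hz _ => hz)
  have hB := circleAverage_mono_codiscrete hr0 (hhi r) ((hfi r).add (hlow2 r))
    (hlower.mono fun z hz hzr => hz fun j => by
      rw [mem_sphere_zero_iff_norm, abs_of_pos (by linarith)] at hzr
      rw [hzr]
      exact hrR j)
  rw [Real.circleAverage_add (hhi r) (hup2 r), Real.circleAverage_fun_add (hpow r) (hlog r),
    circleAverage_comp_norm (fun x => C * (1 + x) ^ (q - 1)) (by linarith),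
    circleAverage_comp_norm (fun x => Real.log ((n + 1) * D * (1 + x) ^ N)) (by linarith)] at hA
  rw [Real.circleAverage_add (hfi r) (hlow2 r), Real.circleAverage_fun_add (hpow r) (hsum r),
    circleAverage_comp_norm (fun x => C * (1 + x) ^ (q - 1)) (by linarith),
    Real.circleAverage_fun_sum fun j _ => hEi j r] at hB
  have hK : ∑ j, Real.circleAverage (E j) 0 r ≤ (∑ j, |K j|) * Real.log r := by
    rw [Finset.sum_mul]
    refine Finset.sum_le_sum fun j _ => (hr1 j).trans ?_
    gcongr
    exact le_abs_self _
  have hK0 : 0 ≤ (∑ j, |K j|) * Real.log r := by positivity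
  have hN0 : 0 ≤ (1 + 2 * (N : ℝ)) * Real.log r := by positivity
  rw [one_mul, Real.norm_eq_abs, Real.norm_eq_abs]
  refine le_trans ?_ (le_abs_self _)
  rw [abs_le, add_mul]
  constructor <;> linarith

theorem eq_smul_of_inner_eq_zero {d x : ℂ} (hx : x ≠ 0) (h : inner ℝ d x = 0) :
    d = ((inner ℝ d (Complex.I * x) / Complex.normSq x : ℝ) : ℂ) * (Complex.I * x) := by
  have hN : Complex.normSq x ≠ 0 := by simpa using hx
  rw [Complex.inner, Complex.mul_re, Complex.conj_re, Complex.conj_im] at h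
  rw [Complex.inner]
  apply Complex.ext
  · simp only [Complex.mul_re, Complex.mul_im, Complex.conj_re, Complex.conj_im, Complex.I_re,
      Complex.I_im, Complex.ofReal_re, Complex.ofReal_im]
    field_simp
    rw [Complex.normSq_apply]
    linear_combination x.re * h
  · simp only [Complex.mul_re, Complex.mul_im, Complex.conj_re, Complex.conj_im, Complex.I_re,
      Complex.I_im, Complex.ofReal_re, Complex.ofReal_im]
    field_simp
    rw [Complex.normSq_apply]
    linear_combination x.im * h

theorem inner_smul_I_mul (t : ℝ) (x c : ℂ) :
    ((starRingEnd ℂ) ((t : ℂ) * (Complex.I * x)) * c).im = -(t * inner ℝ c x) := by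
  rw [Complex.inner]
  simp only [Complex.mul_re, Complex.mul_im, Complex.conj_re, Complex.conj_im, Complex.I_re,
    Complex.I_im, Complex.ofReal_re, Complex.ofReal_im]
  ring

theorem inner_le_of_mem_convexHull {G : Set ℂ} {x : ℂ} {m : ℝ} (h : ∀ c ∈ G, inner ℝ c x ≤ m)
    {z : ℂ} (hz : z ∈ convexHull ℝ G) : inner ℝ z x ≤ m := by
  have hconv : Convex ℝ {z : ℂ | inner ℝ z x ≤ m} := by
    refine convex_halfSpace_le (f := fun z : ℂ => inner ℝ z x) ⟨?_, ?_⟩ m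
    · intro a b
      exact inner_add_left a b x
    · intro t a
      rw [real_inner_smul_left, smul_eq_mul]
  exact convexHull_min h hconv hz

theorem mem_extremePoints_of_unique_max {G : Set ℂ} {b y : ℂ} (hb : b ∈ G)
    (h : ∀ c ∈ G, c ≠ b → inner ℝ c y < inner ℝ b y) :
    b ∈ Set.extremePoints ℝ (convexHull ℝ G) := by
  have hconv : Convex ℝ {z : ℂ | z ≠ b → inner ℝ z y < inner ℝ b y} := by
    intro z hz w hw s t hs ht hst hne
    have hz' : inner ℝ z y ≤ inner ℝ b y := by
      by_cases hzb : z = b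
      · rw [hzb]
      · exact (hz hzb).le
    have hw' : inner ℝ w y ≤ inner ℝ b y := by
      by_cases hwb : w = b
      · rw [hwb]
      · exact (hw hwb).le
    rw [inner_add_left, real_inner_smul_left, real_inner_smul_left]
    have hsum : s * inner ℝ b y + t * inner ℝ b y = inner ℝ b y := by
      rw [← add_mul, hst, one_mul]
    have hsz := mul_le_mul_of_nonneg_left hz' hs
    have htw := mul_le_mul_of_nonneg_left hw' ht
    by_cases hzb : z = b
    · have hwb : w ≠ b := by
        rintro rfl
        refine hne ?_
        rw [hzb, ← add_smul, hst, one_smul]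
      have ht0 : 0 < t := by
        rcases ht.lt_or_eq with h0 | h0
        · exact h0
        · refine absurd ?_ hne
          rw [← h0, zero_smul, add_zero, hzb, show s = 1 by linarith, one_smul]
      have := mul_lt_mul_of_pos_left (hw hwb) ht0
      linarith
    · rcases hs.lt_or_eq with h0 | h0
      · have := mul_lt_mul_of_pos_left (hz hzb) h0
        linarith
      · have hwb : w ≠ b := by
          rintro rfl
          refine hne ?_
          rw [← h0, zero_smul, zero_add, show t = 1 by linarith, one_smul]
        have := mul_lt_mul_of_pos_left (hw hwb) (by linarith : 0 < t)
        linarith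
  have hK := convexHull_min (t := {z : ℂ | z ≠ b → inner ℝ z y < inner ℝ b y}) h hconv
  refine mem_extremePoints.2 ⟨subset_convexHull ℝ G hb, fun z hz w hw hbs => ?_⟩
  obtain ⟨s, t, hs, ht, hst, hzw⟩ := hbs
  have hin : inner ℝ b y = s * inner ℝ z y + t * inner ℝ w y := by
    rw [← hzw, inner_add_left, real_inner_smul_left, real_inner_smul_left]
  have hs' : s = 1 - t := by linarith
  have hz' : inner ℝ z y ≤ inner ℝ b y := by
    by_cases hzb : z = b
    · rw [hzb]
    · exact (hK hz hzb).le
  have hw' : inner ℝ w y ≤ inner ℝ b y := by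
    by_cases hwb : w = b
    · rw [hwb]
    · exact (hK hw hwb).le
  constructor
  · by_contra hzb
    have h1 : inner ℝ z y < inner ℝ b y := hK hz hzb
    have h2 := mul_lt_mul_of_pos_left h1 hs
    have h3 := mul_le_mul_of_nonneg_left hw' ht.le
    have h4 : s * inner ℝ b y + t * inner ℝ b y = inner ℝ b y := by
      rw [← add_mul, hst, one_mul]
    linarith
  · by_contra hwb
    have h1 : inner ℝ w y < inner ℝ b y := hK hw hwb
    have h2 := mul_lt_mul_of_pos_left h1 ht
    have h3 := mul_le_mul_of_nonneg_left hz' hs.le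
    have h4 : s * inner ℝ b y + t * inner ℝ b y = inner ℝ b y := by
      rw [← add_mul, hst, one_mul]
    linarith

/-- A maximizer of `⟪·, x⟫` which among all maximizers is the unique one for `⟪·, v⟫` is a
vertex. -/
theorem mem_extremePoints_of_lex_max {G : Finset ℂ} {b x v : ℂ} (hb : b ∈ G)
    (h1 : ∀ c ∈ G, inner ℝ c x ≤ inner ℝ b x)
    (h2 : ∀ c ∈ G, inner ℝ c x = inner ℝ b x → c ≠ b → inner ℝ c v < inner ℝ b v) :
    b ∈ Set.extremePoints ℝ (convexHull ℝ (G : Set ℂ)) := by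
  have hev : ∀ᶠ ε : ℝ in nhdsWithin 0 (Set.Ioi 0), ∀ c ∈ G, c ≠ b →
      inner ℝ c (x + ε • v) < inner ℝ b (x + ε • v) := by
    rw [eventually_all_finset]
    intro c hc
    rcases (h1 c hc).lt_or_eq with hlt | heq
    · have hcont : ∀ a : ℂ, Continuous fun ε : ℝ => inner ℝ a (x + ε • v) := fun a => by fun_prop
      have := (hcont c).continuousAt.eventually_lt (hcont b).continuousAt (x₀ := 0)
        (by simpa using hlt)
      filter_upwards [nhdsWithin_le_nhds this] with ε hε _ using hε
    · filter_upwards [self_mem_nhdsWithin] with ε hε hcb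
      rw [inner_add_right, inner_add_right, real_inner_smul_right, real_inner_smul_right, heq]
      have := mul_lt_mul_of_pos_left (h2 c hc heq hcb) hε
      linarith
  obtain ⟨ε, hε⟩ := hev.exists
  exact mem_extremePoints_of_unique_max hb hε

/-- The support function of a finite set. -/
noncomputable def supportFun (G : Finset ℂ) (hG : G.Nonempty) (x : ℂ) : ℝ :=
  G.sup' hG fun a => inner ℝ a x

theorem inner_le_supportFun {G : Finset ℂ} (hG : G.Nonempty) {a : ℂ} (ha : a ∈ G) (x : ℂ) :
    inner ℝ a x ≤ supportFun G hG x :=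
  Finset.le_sup' (fun a => inner ℝ a x) ha

/-- The face of `G` in direction `x₀` has endpoints `a`, `b`: these determine the support function
near `x₀`, and `(a, b)` is the only directed side with outer normal `x₀`. -/
theorem exists_face_endpoints (G : Finset ℂ) (hG : G.Nonempty) {x₀ : ℂ} (hx₀ : x₀ ≠ 0) :
    ∃ a ∈ G, ∃ b ∈ G,
      (∀ᶠ x in nhds x₀, supportFun G hG x = max (inner ℝ a x) (inner ℝ b x)) ∧
      ∀ a' ∈ G, ∀ b' ∈ G, (IsDirectedSide (convexHull ℝ (G : Set ℂ)) a' b' ∧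
        ∃ s : ℝ, 0 < s ∧ b' - a' = (s : ℂ) * (Complex.I * x₀)) ↔ (a' = a ∧ b' = b ∧ a ≠ b) := by
  set m := supportFun G hG x₀ with hm
  set v := Complex.I * x₀ with hv
  have hN : 0 < Complex.normSq x₀ := Complex.normSq_pos.2 hx₀
  set F := G.filter fun c => inner ℝ c x₀ = m with hF
  have hFne : F.Nonempty := by
    obtain ⟨c, hc, hcm⟩ := Finset.exists_mem_eq_sup' hG fun a : ℂ => inner ℝ a x₀
    exact ⟨c, Finset.mem_filter.2 ⟨hc, hcm.symm⟩⟩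
  obtain ⟨b, hbF, hb⟩ := F.exists_max_image (fun c => inner ℝ c v) hFne
  obtain ⟨a, haF, ha⟩ := F.exists_min_image (fun c => inner ℝ c v) hFne
  obtain ⟨hbG, hbm⟩ := Finset.mem_filter.1 hbF
  obtain ⟨haG, ham⟩ := Finset.mem_filter.1 haF
  have hle : ∀ c ∈ G, inner ℝ c x₀ ≤ m := fun c hc => inner_le_supportFun hG hc x₀
  have hrep : ∀ c d : ℂ, inner ℝ c x₀ = m → inner ℝ d x₀ = m →
      c - d = (((inner ℝ c v - inner ℝ d v) / Complex.normSq x₀ : ℝ) : ℂ) * v := by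
    intro c d hc hd
    have := eq_smul_of_inner_eq_zero (d := c - d) hx₀ (by rw [inner_sub_left, hc, hd, sub_self])
    rwa [inner_sub_left] at this
  have hinj : ∀ c d : ℂ, inner ℝ c x₀ = m → inner ℝ d x₀ = m → inner ℝ c v = inner ℝ d v →
      c = d := by
    intro c d hc hd hcd
    have := hrep c d hc hd
    rw [hcd, sub_self, zero_div, Complex.ofReal_zero, zero_mul] at this
    exact sub_eq_zero.1 this
  have hvv : inner ℝ v v = Complex.normSq x₀ := by
    rw [real_inner_self_eq_norm_sq, hv, norm_mul, Complex.norm_I, one_mul, Complex.normSq_eq_norm_sq]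
  have hvx : inner ℝ v x₀ = 0 := by
    rw [Complex.inner, hv]
    simp only [Complex.mul_re, Complex.mul_im, Complex.conj_re, Complex.conj_im, Complex.I_re,
      Complex.I_im]
    ring
  have hsmul : ∀ (s : ℝ) (y : ℂ), inner ℝ ((s : ℂ) * v) y = s * inner ℝ v y := fun s y => by
    rw [← Complex.real_smul, real_inner_smul_left]
  refine ⟨a, haG, b, hbG, ?_, ?_⟩
  · have hev : ∀ᶠ x in nhds x₀, ∀ c ∈ G, inner ℝ c x₀ ≠ m → inner ℝ c x < inner ℝ a x := by
      rw [eventually_all_finset]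
      intro c hc
      by_cases hcm : inner ℝ c x₀ = m
      · exact Eventually.of_forall fun x h => absurd hcm h
      · have hcont : ∀ d : ℂ, Continuous fun x : ℂ => inner ℝ d x := fun d => by fun_prop
        have := (hcont c).continuousAt.eventually_lt (hcont a).continuousAt (x₀ := x₀)
          (by rw [ham]; exact lt_of_le_of_ne (hle c hc) hcm)
        exact this.mono fun x hx _ => hx
    filter_upwards [hev] with x hx
    refine le_antisymm (Finset.sup'_le _ _ fun c hc => ?_)
      (max_le (inner_le_supportFun hG haG x) (inner_le_supportFun hG hbG x))
    by_cases hcm : inner ℝ c x₀ = m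
    · have hcF : c ∈ F := Finset.mem_filter.2 ⟨hc, hcm⟩
      have h1 := hrep c a hcm ham
      have h2 := hrep b c hbm hcm
      have h3 : inner ℝ c x = inner ℝ a x
          + (inner ℝ c v - inner ℝ a v) / Complex.normSq x₀ * inner ℝ v x := by
        rw [← hsmul, ← h1, inner_sub_left]
        ring
      have h4 : inner ℝ c x = inner ℝ b x
          - (inner ℝ b v - inner ℝ c v) / Complex.normSq x₀ * inner ℝ v x := by
        rw [← hsmul, ← h2, inner_sub_left]
        ring
      have h5 : 0 ≤ (inner ℝ c v - inner ℝ a v) / Complex.normSq x₀ :=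
        div_nonneg (sub_nonneg.2 (ha c hcF)) hN.le
      have h6 : 0 ≤ (inner ℝ b v - inner ℝ c v) / Complex.normSq x₀ :=
        div_nonneg (sub_nonneg.2 (hb c hcF)) hN.le
      rcases le_total (inner ℝ v x) 0 with h7 | h7
      · refine le_max_of_le_left ?_
        rw [h3]
        have := mul_nonpos_of_nonneg_of_nonpos h5 h7
        linarith
      · refine le_max_of_le_right ?_
        rw [h4]
        have := mul_nonneg h6 h7
        linarith
    · exact le_max_of_le_left (hx c hc hcm).le
  · intro a' ha' b' hb'
    constructor
    · rintro ⟨hside, s, hs, hab⟩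
      have h1 : ∀ z ∈ (G : Set ℂ), inner ℝ z x₀ ≤ inner ℝ a' x₀ := by
        intro z hz
        have := hside.half_plane z (subset_convexHull ℝ _ hz)
        rw [hab, inner_smul_I_mul, inner_sub_left] at this
        have h2 : s * (inner ℝ z x₀ - inner ℝ a' x₀) ≤ 0 := by linarith
        have h3 := nonpos_of_mul_nonpos_right h2 hs
        linarith
      have ha'm : inner ℝ a' x₀ = m := le_antisymm (hle a' ha') (by rw [← ham]; exact h1 a haG)
      have hb'eq : b' = a' + (s : ℂ) * v := by rw [← hab]; ring
      have hb'm : inner ℝ b' x₀ = m := by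
        rw [hb'eq, inner_add_left, hsmul, hvx, mul_zero, add_zero, ha'm]
      have hb'v : inner ℝ b' v = inner ℝ a' v + s * Complex.normSq x₀ := by
        rw [hb'eq, inner_add_left, hsmul, hvv]
      have hlt : inner ℝ a' v < inner ℝ b' v := by
        rw [hb'v]
        have := mul_pos hs hN
        linarith
      have ha1 := ha a' (Finset.mem_filter.2 ⟨ha', ha'm⟩)
      have hb1 := hb b' (Finset.mem_filter.2 ⟨hb', hb'm⟩)
      have hseg : ∀ c, inner ℝ c x₀ = m → inner ℝ a v < inner ℝ c v → inner ℝ c v < inner ℝ b v →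
          c ∉ Set.extremePoints ℝ (convexHull ℝ (G : Set ℂ)) := by
        intro c hcm hac hcb hext
        have h2 := mem_extremePoints.1 hext
        have h3 := (h2.2 a (subset_convexHull ℝ _ haG) b (subset_convexHull ℝ _ hbG) ?_).1
        · rw [h3] at hac
          exact lt_irrefl _ hac
        · rw [openSegment_eq_image']
          have h4 : 0 < inner ℝ b v - inner ℝ a v := by linarith
          refine ⟨(inner ℝ c v - inner ℝ a v) / (inner ℝ b v - inner ℝ a v),
            ⟨div_pos (by linarith) h4, (div_lt_one h4).2 (by linarith)⟩, ?_⟩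
          have h5 := hrep c a hcm ham
          dsimp only
          rw [hrep b a hbm ham, Complex.real_smul, ← mul_assoc, ← Complex.ofReal_mul,
            div_mul_div_cancel₀ h4.ne', ← h5]
          · ring
      have haa : inner ℝ a' v = inner ℝ a v := by
        by_contra hne
        exact hseg a' ha'm (lt_of_le_of_ne ha1 (Ne.symm hne)) (hlt.trans_le hb1) hside.left_vertex
      have hbb : inner ℝ b' v = inner ℝ b v := by
        by_contra hne
        exact hseg b' hb'm (ha1.trans_lt hlt) (lt_of_le_of_ne hb1 hne) hside.right_vertex
      have e1 := hinj a' a ha'm ham haa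
      have e2 := hinj b' b hb'm hbm hbb
      exact ⟨e1, e2, by rw [← e1, ← e2]; exact hside.ne⟩
    · rintro ⟨rfl, rfl, hne⟩
      have h1 := hrep b' a' hbm ham
      set s := (inner ℝ b' v - inner ℝ a' v) / Complex.normSq x₀ with hs
      have hs0 : 0 < s := by
        refine div_pos ?_ hN
        rcases (ha b' hbF).lt_or_eq with h2 | h2
        · linarith
        · exact absurd (hinj _ _ ham hbm h2) hne
      refine ⟨⟨?_, ?_, hne, ?_⟩, s, hs0, h1⟩
      · refine mem_extremePoints_of_lex_max (x := x₀) (v := -v) haG (by rwa [ham]) ?_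
        intro c hc hcm hca
        rw [ham] at hcm
        rw [inner_neg_right, inner_neg_right, neg_lt_neg_iff]
        exact lt_of_le_of_ne (ha c (Finset.mem_filter.2 ⟨hc, hcm⟩))
          fun h => hca (hinj _ _ hcm ham h.symm)
      · refine mem_extremePoints_of_lex_max (x := x₀) (v := v) hbG (by rwa [hbm]) ?_
        intro c hc hcm hcb
        rw [hbm] at hcm
        exact lt_of_le_of_ne (hb c (Finset.mem_filter.2 ⟨hc, hcm⟩))
          fun h => hcb (hinj _ _ hcm hbm h)
      · intro z hz
        rw [h1, inner_smul_I_mul, inner_sub_left, ham]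
        have := inner_le_of_mem_convexHull hle hz
        nlinarith

open Classical in
/-- The directed sides of the convex hull of `G`. -/
noncomputable def directedSides (G : Finset ℂ) : Finset (ℂ × ℂ) :=
  (G ×ˢ G).filter fun p => IsDirectedSide (convexHull ℝ (G : Set ℂ)) p.1 p.2

theorem hullCircumference_eq_sum (G : Finset ℂ) :
    hullCircumference G = ∑ p ∈ directedSides G, ‖p.2 - p.1‖ := rfl

/-- `d` is a positive multiple of `v`. -/
def HasDirection (v d : ℂ) : Prop := ∃ s : ℝ, 0 < s ∧ d = (s : ℂ) * v

open Classical in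
theorem exists_supportFun_eq_and_sum_sides (G : Finset ℂ) (hG : G.Nonempty) {x₀ : ℂ}
    (hx₀ : x₀ ≠ 0) : ∃ a b : ℂ,
      (∀ᶠ x in nhds x₀, 2 * supportFun G hG x = inner ℝ (a + b) x + |inner ℝ (b - a) x|) ∧
      ∀ x, ∑ p ∈ (directedSides G).filter
        (fun p => HasDirection (Complex.I * x₀) (p.2 - p.1)),
          |inner ℝ (p.2 - p.1) x| = |inner ℝ (b - a) x| := by
  obtain ⟨a, ha, b, hb, h1, h2⟩ := exists_face_endpoints G hG hx₀
  refine ⟨a, b, h1.mono fun x hx => ?_, fun x => ?_⟩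
  · rw [hx, inner_add_left, inner_sub_left]
    rcases le_total (inner ℝ a x) (inner ℝ b x) with h | h
    · rw [max_eq_right h, abs_of_nonneg (by linarith)]
      ring
    · rw [max_eq_left h, abs_of_nonpos (by linarith)]
      ring
  · by_cases hab : a = b
    · rw [Finset.sum_eq_zero, hab, sub_self, inner_zero_left, abs_zero]
      intro p hp
      obtain ⟨hp1, hp2⟩ := Finset.mem_filter.1 hp
      obtain ⟨hp3, hp4⟩ := Finset.mem_filter.1 hp1
      obtain ⟨hp5, hp6⟩ := Finset.mem_product.1 hp3
      exact absurd hab ((h2 _ hp5 _ hp6).1 ⟨hp4, hp2⟩).2.2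
    · refine (Finset.sum_eq_single (a, b) ?_ ?_).trans rfl
      · intro p hp hne
        obtain ⟨hp1, hp2⟩ := Finset.mem_filter.1 hp
        obtain ⟨hp3, hp4⟩ := Finset.mem_filter.1 hp1
        obtain ⟨hp5, hp6⟩ := Finset.mem_product.1 hp3
        obtain ⟨e1, e2, -⟩ := (h2 _ hp5 _ hp6).1 ⟨hp4, hp2⟩
        exact absurd (Prod.ext e1 e2) hne
      · intro hnot
        refine absurd ?_ hnot
        obtain ⟨e1, e2⟩ := (h2 a ha b hb).2 ⟨rfl, rfl, hab⟩
        exact Finset.mem_filter.2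
          ⟨Finset.mem_filter.2 ⟨Finset.mem_product.2 ⟨ha, hb⟩, e1⟩, e2⟩

theorem eventually_abs_inner_eq {d x₀ : ℂ} (h : inner ℝ d x₀ ≠ 0) :
    ∃ e : ℂ, ∀ᶠ x in nhds x₀, |inner ℝ d x| = inner ℝ e x := by
  have hc : Continuous fun x : ℂ => inner ℝ d x := by fun_prop
  rcases lt_or_gt_of_ne h with h0 | h0
  · refine ⟨-d, (hc.continuousAt.eventually_lt continuousAt_const h0).mono fun x hx => ?_⟩
    rw [inner_neg_left, abs_of_neg hx]
  · refine ⟨d, (continuousAt_const.eventually_lt hc.continuousAt h0).mono fun x hx => ?_⟩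
    rw [abs_of_pos hx]

theorem exists_eventually_sum_eq_inner {α : Type*} (s : Finset α) (φ : α → ℂ → ℝ) {x₀ : ℂ}
    (h : ∀ p ∈ s, ∃ e : ℂ, ∀ᶠ x in nhds x₀, φ p x = inner ℝ e x) :
    ∃ e : ℂ, ∀ᶠ x in nhds x₀, ∑ p ∈ s, φ p x = inner ℝ e x := by
  choose! e he using h
  refine ⟨∑ p ∈ s, e p, ?_⟩
  filter_upwards [(eventually_all_finset s).2 he] with x hx
  rw [sum_inner]
  exact Finset.sum_congr rfl hx

/-- Twice the width of `G` minus the total projected length of its sides. -/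
noncomputable def widthDefect (G : Finset ℂ) (hG : G.Nonempty) (x : ℂ) : ℝ :=
  2 * supportFun G hG x + 2 * supportFun G hG (-x) -
    ∑ p ∈ directedSides G, |inner ℝ (p.2 - p.1) x|

theorem exists_eventually_widthDefect_eq_inner (G : Finset ℂ) (hG : G.Nonempty) {x₀ : ℂ}
    (hx₀ : x₀ ≠ 0) : ∃ e : ℂ, ∀ᶠ x in nhds x₀, widthDefect G hG x = inner ℝ e x := by
  classical
  obtain ⟨a, b, h1, h2⟩ := exists_supportFun_eq_and_sum_sides G hG hx₀
  obtain ⟨a', b', h3, h4⟩ := exists_supportFun_eq_and_sum_sides G hG (neg_ne_zero.2 hx₀)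
  have h3' : ∀ᶠ x in nhds x₀, 2 * supportFun G hG (-x) =
      -inner ℝ (a' + b') x + |inner ℝ (b' - a') x| := by
    have hn : Tendsto (fun x : ℂ => -x) (nhds x₀) (nhds (-x₀)) := continuous_neg.tendsto x₀
    exact (hn.eventually h3).mono fun x hx => by rw [hx, inner_neg_right, inner_neg_right, abs_neg]
  have hdisj : ∀ d, HasDirection (Complex.I * -x₀) d → ¬HasDirection (Complex.I * x₀) d := by
    rintro d ⟨s, hs, hs'⟩ ⟨t, ht, ht'⟩
    rw [hs'] at ht'
    have h5 : ((s + t : ℝ) : ℂ) * (Complex.I * x₀) = 0 := by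
      push_cast
      linear_combination -ht'
    have h6 : ((s + t : ℝ) : ℂ) ≠ 0 := Complex.ofReal_ne_zero.2 (by linarith)
    exact mul_ne_zero h6 (mul_ne_zero Complex.I_ne_zero hx₀) h5
  set pos : ℂ × ℂ → Prop := fun p => HasDirection (Complex.I * x₀) (p.2 - p.1) with hpos
  set neg : ℂ × ℂ → Prop := fun p => HasDirection (Complex.I * -x₀) (p.2 - p.1) with hneg
  generalize hS : directedSides G = S
  rw [hS] at h2 h4
  have hSne : ∀ p ∈ S, p.1 ≠ p.2 := fun p hp => by
    rw [← hS] at hp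
    exact (Finset.mem_filter.1 hp).2.ne
  have hrest : ∀ p ∈ (S.filter fun p => ¬pos p).filter fun p => ¬neg p,
      ∃ e : ℂ, ∀ᶠ x in nhds x₀, |inner ℝ (p.2 - p.1) x| = inner ℝ e x := by
    intro p hp
    obtain ⟨hp1, hp2⟩ := Finset.mem_filter.1 hp
    obtain ⟨hp3, hp4⟩ := Finset.mem_filter.1 hp1
    have hne : p.1 ≠ p.2 := hSne p hp3
    refine eventually_abs_inner_eq fun h0 => ?_
    have h5 := eq_smul_of_inner_eq_zero hx₀ h0
    set t := inner ℝ (p.2 - p.1) (Complex.I * x₀) / Complex.normSq x₀ with ht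
    rcases lt_trichotomy t 0 with h | h | h
    · refine hp2 ⟨-t, by linarith, ?_⟩
      rw [h5]
      push_cast
      ring
    · rw [h, Complex.ofReal_zero, zero_mul] at h5
      exact hne (sub_eq_zero.1 h5).symm
    · exact hp4 ⟨t, h, h5⟩
  obtain ⟨e, he⟩ := exists_eventually_sum_eq_inner _
    (fun (p : ℂ × ℂ) (x : ℂ) => |(inner ℝ (p.2 - p.1) x : ℝ)|) hrest
  refine ⟨(a + b) - (a' + b') - e, ?_⟩
  filter_upwards [h1, h3', he] with x hx1 hx3 hxe
  have hnegs : (S.filter fun p => ¬pos p).filter neg = S.filter neg := by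
    rw [Finset.filter_filter]
    exact Finset.filter_congr fun p _ => ⟨fun h => h.2, fun h => ⟨hdisj _ h, h⟩⟩
  rw [widthDefect, hS, ← Finset.sum_filter_add_sum_filter_not S pos,
    ← Finset.sum_filter_add_sum_filter_not (S.filter fun p => ¬pos p) neg, hnegs, hxe, hx1, hx3,
    h2 x, h4 x, inner_sub_left (a + b - (a' + b')) e, inner_sub_left (a + b)]
  ring

theorem widthDefect_neg (G : Finset ℂ) (hG : G.Nonempty) (x : ℂ) :
    widthDefect G hG (-x) = widthDefect G hG x := by
  simp only [widthDefect, neg_neg, inner_neg_right, abs_neg]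
  ring

/-- A function on the punctured plane that is locally `ℝ`-linear is globally so. -/
theorem exists_forall_eq_of_locally_linear {D : ℂ → ℝ}
    (h : ∀ x₀ : ℂ, x₀ ≠ 0 → ∃ e : ℂ, ∀ᶠ x in nhds x₀, D x = inner ℝ e x) :
    ∃ L : ℂ →L[ℝ] ℝ, ∀ x, x ≠ 0 → D x = L x := by
  have hloc : ∀ x₀ : ℂ, x₀ ≠ 0 → ∃ L : ℂ →L[ℝ] ℝ, ∀ᶠ x in nhds x₀, D x = L x := by
    intro x₀ hx₀
    obtain ⟨e, he⟩ := h x₀ hx₀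
    exact ⟨innerSL ℝ e, he⟩
  have hfd : ∀ x₀ : ℂ, ∀ L : ℂ →L[ℝ] ℝ, (∀ᶠ x in nhds x₀, D x = L x) →
      fderiv ℝ D =ᶠ[nhds x₀] fun _ => L := by
    intro x₀ L hL
    filter_upwards [eventually_eventually_nhds.2 hL] with x hx
    have h1 : D =ᶠ[nhds x] L := hx
    rw [h1.fderiv_eq, L.fderiv]
  have hopen : IsOpen ({0}ᶜ : Set ℂ) := isOpen_compl_singleton
  have hconn : IsPreconnected ({0}ᶜ : Set ℂ) :=
    (isConnected_compl_singleton_of_one_lt_rank (by simp) 0).isPreconnected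
  refine ⟨fderiv ℝ D 1, fun x hx => ?_⟩
  have hconst : fderiv ℝ D x = fderiv ℝ D 1 := by
    refine hopen.is_const_of_fderiv_eq_zero (𝕜 := ℝ) hconn (fun y hy => ?_) (fun y hy => ?_) hx
      one_ne_zero
    · obtain ⟨L, hL⟩ := hloc y hy
      exact ((hfd y L hL).differentiableAt_iff.2 (differentiableAt_const L)).differentiableWithinAt
    · obtain ⟨L, hL⟩ := hloc y hy
      rw [(hfd y L hL).fderiv_eq]
      simp
  obtain ⟨L, hL⟩ := hloc x hx
  rw [← hconst, (hfd x L hL).self_of_nhds, hL.self_of_nhds]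

/-- The width of a finite set in each direction is half of the total projected length of the sides
of its convex hull. -/
theorem sum_abs_inner_sides (G : Finset ℂ) (hG : G.Nonempty) {x : ℂ} (hx : x ≠ 0) :
    ∑ p ∈ directedSides G, |inner ℝ (p.2 - p.1) x| =
      2 * supportFun G hG x + 2 * supportFun G hG (-x) := by
  obtain ⟨L, hL⟩ := exists_forall_eq_of_locally_linear
    fun x₀ hx₀ => exists_eventually_widthDefect_eq_inner G hG hx₀
  have h1 := widthDefect_neg G hG x
  rw [hL x hx, hL (-x) (neg_ne_zero.2 hx), map_neg] at h1
  have h2 := hL x hx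
  rw [widthDefect] at h2
  linarith

theorem continuous_supportFun (G : Finset ℂ) (hG : G.Nonempty) : Continuous (supportFun G hG) := by
  unfold supportFun
  exact Continuous.finset_sup'_apply _ fun j _ => by fun_prop

theorem integral_abs_sin_sub (α : ℝ) :
    ∫ θ in (0 : ℝ)..2 * Real.pi, |Real.sin (θ - α)| = 4 := by
  have hper : Function.Periodic (fun θ : ℝ => |Real.sin θ|) Real.pi := fun θ => by
    simp [Real.sin_add_pi]
  have hcont : Continuous fun θ : ℝ => |Real.sin θ| := by fun_prop
  have h1 : ∫ θ in (0 : ℝ)..Real.pi, |Real.sin θ| = 2 := by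
    rw [intervalIntegral.integral_congr (g := Real.sin)]
    · rw [integral_sin]
      norm_num
    · intro θ hθ
      rw [Set.uIcc_of_le Real.pi_pos.le] at hθ
      exact abs_of_nonneg (Real.sin_nonneg_of_mem_Icc hθ)
  rw [intervalIntegral.integral_comp_sub_right (fun θ : ℝ => |Real.sin θ|)]
  have h2 := hper.intervalIntegral_add_zsmul_eq 2 (0 - α) (fun a b => hcont.intervalIntegrable a b)
  have h3 := hper.intervalIntegral_add_eq (0 - α) 0
  rw [zero_add, h1] at h3
  simp only [zsmul_eq_mul] at h2
  rw [h3] at h2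
  rw [show 2 * Real.pi - α = 0 - α + ((2 : ℤ) : ℝ) * Real.pi by push_cast; ring, h2]
  norm_num

theorem circleAverage_abs_inner (d : ℂ) :
    Real.circleAverage (fun z => |inner ℝ d z|) 0 1 = 2 * ‖d‖ / Real.pi := by
  have h1 : ∀ θ : ℝ, |inner ℝ d (circleMap 0 1 θ)| = ‖d‖ * |Real.sin (θ - (d.arg - Real.pi / 2))| := by
    intro θ
    have h2 : inner ℝ d (circleMap 0 1 θ) = ‖d‖ * Real.cos (θ - d.arg) := by
      rw [Complex.inner, circleMap_zero]
      have hre := Complex.norm_mul_cos_arg d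
      have him := Complex.norm_mul_sin_arg d
      rw [Real.cos_sub, Complex.ofReal_one, one_mul, Complex.mul_re, Complex.conj_re,
        Complex.conj_im, Complex.exp_ofReal_mul_I_re, Complex.exp_ofReal_mul_I_im, ← hre, ← him]
      ring
    rw [h2, abs_mul, abs_norm, ← sub_add, Real.sin_add_pi_div_two]
  unfold Real.circleAverage
  simp_rw [h1]
  rw [intervalIntegral.integral_const_mul, integral_abs_sin_sub, smul_eq_mul]
  field_simp
  ring

theorem circleAverage_comp_neg (φ : ℂ → ℝ) :
    Real.circleAverage (fun z => φ (-z)) 0 1 = Real.circleAverage φ 0 1 := by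
  rw [← Real.circleAverage_neg_radius (f := φ)]
  unfold Real.circleAverage
  congr 2
  ext θ
  simp [circleMap_zero]

/-- Cauchy's formula: the mean of the support function over the unit circle is the circumference
of the convex hull divided by `2π`. -/
theorem circleAverage_supportFun (G : Finset ℂ) (hG : G.Nonempty) :
    Real.circleAverage (supportFun G hG) 0 1 = hullCircumference G / (2 * Real.pi) := by
  have hci : ∀ φ : ℂ → ℝ, Continuous φ → CircleIntegrable φ 0 1 := fun φ hφ =>
    hφ.continuousOn.circleIntegrable'
  have hs := continuous_supportFun G hG
  have h1 : Real.circleAverage (fun z => ∑ p ∈ directedSides G, |inner ℝ (p.2 - p.1) z|) 0 1 =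
      Real.circleAverage (fun z => 2 * supportFun G hG z + 2 * supportFun G hG (-z)) 0 1 := by
    refine Real.circleAverage_congr_sphere fun z hz => ?_
    refine sum_abs_inner_sides G hG fun h0 => ?_
    rw [h0] at hz
    simp at hz
  rw [Real.circleAverage_fun_sum fun p _ => hci _ (by fun_prop),
    Real.circleAverage_fun_add (hci _ (by fun_prop)) (hci _ (by fun_prop))] at h1
  have h2 : Real.circleAverage (fun z => 2 * supportFun G hG z) 0 1
      = 2 * Real.circleAverage (supportFun G hG) 0 1 :=
    Real.circleAverage_fun_smul (a := (2 : ℝ)) (f := supportFun G hG)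
  have h3 : Real.circleAverage (fun z => 2 * supportFun G hG (-z)) 0 1
      = 2 * Real.circleAverage (supportFun G hG) 0 1 := by
    rw [← circleAverage_comp_neg (supportFun G hG)]
    exact Real.circleAverage_fun_smul (a := (2 : ℝ)) (f := fun z => supportFun G hG (-z))
  rw [h2, h3] at h1
  simp_rw [circleAverage_abs_inner] at h1
  rw [← Finset.sum_div, ← Finset.mul_sum, ← hullCircumference_eq_sum] at h1
  have hpi := Real.pi_ne_zero
  field_simp at h1 ⊢
  linarith

theorem circleAverage_comp_pow (φ : ℂ → ℝ) (hφ : Continuous φ) {q : ℕ} (hq : 1 ≤ q) :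
    Real.circleAverage (fun z => φ (z ^ q)) 0 1 = Real.circleAverage φ 0 1 := by
  have hq0 : (q : ℝ) ≠ 0 := by positivity
  unfold Real.circleAverage
  congr 1
  have h1 : ∀ θ : ℝ, φ (circleMap 0 1 θ ^ q) = φ (circleMap 0 1 (θ * q)) := by
    intro θ
    congr 1
    rw [circleMap_zero, circleMap_zero, mul_pow, ← Complex.exp_nat_mul]
    push_cast
    rw [one_pow]
    ring_nf
  simp_rw [h1]
  have hper : Function.Periodic (fun θ : ℝ => φ (circleMap 0 1 θ)) (2 * Real.pi) := fun θ => by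
    simp only [periodic_circleMap 0 1 θ]
  have hcont : Continuous fun θ : ℝ => φ (circleMap 0 1 θ) := by fun_prop
  rw [intervalIntegral.integral_comp_mul_right (fun θ : ℝ => φ (circleMap 0 1 θ)) hq0, zero_mul]
  have h2 := hper.intervalIntegral_add_zsmul_eq q 0 (fun a b => hcont.intervalIntegrable a b)
  simp only [zero_add, zsmul_eq_mul, Int.cast_natCast] at h2
  rw [mul_comm (2 * Real.pi), h2, smul_eq_mul, inv_mul_cancel_left₀ hq0]

theorem supportFun_real_smul (G : Finset ℂ) (hG : G.Nonempty) {t : ℝ} (ht : 0 ≤ t) (x : ℂ) :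
    supportFun G hG (t * x) = t * supportFun G hG x := by
  unfold supportFun
  rw [Finset.mul₀_sup' ht]
  refine Finset.sup'_congr _ rfl fun a _ => ?_
  rw [← Complex.real_smul, real_inner_smul_right]

open Classical in
theorem leadingHeight_eq_supportFun {n : ℕ} (w : Fin (n + 1) → ℂ) (q : ℕ) (z : ℂ) :
    leadingHeight w q z = supportFun (Finset.univ.image fun j => (starRingEnd ℂ) (w j))
      (Finset.univ_nonempty.image _) (z ^ q) := by
  unfold leadingHeight supportFun
  rw [Finset.sup'_image]
  refine Finset.sup'_congr _ rfl fun j _ => ?_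
  simp only [Function.comp_apply, Complex.inner, Complex.conj_conj, mul_comm]

theorem circleAverage_leadingHeight {n : ℕ} (Q : Fin (n + 1) → ℂ[X]) {q : ℕ}
    (hq : expOrder Q = q) (hq1 : 1 ≤ q) {r : ℝ} (hr : 0 ≤ r) :
    Real.circleAverage (leadingHeight (fun j => (Q j).coeff q) q) 0 r =
      hullCircumference (conjLeadingCoeffs Q) / (2 * Real.pi) * r ^ q := by
  classical
  set G := Finset.univ.image fun j => (starRingEnd ℂ) ((Q j).coeff q) with hG
  have hGne : G.Nonempty := Finset.univ_nonempty.image _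
  have hGe : conjLeadingCoeffs Q = G := by
    rw [conjLeadingCoeffs, hG, hq]
  have h1 : ∀ z, leadingHeight (fun j => (Q j).coeff q) q z = supportFun G hGne (z ^ q) := by
    intro z
    rw [leadingHeight_eq_supportFun]
  rw [hGe, ← circleAverage_supportFun G hGne, ← circleAverage_comp_pow _
    (continuous_supportFun G hGne) hq1, Real.circleAverage_eq_circleAverage_zero_one]
  simp_rw [h1]
  have h2 : ∀ z : ℂ, supportFun G hGne (((r : ℂ) * z + 0) ^ q)
      = r ^ q * supportFun G hGne (z ^ q) := by
    intro z
    rw [add_zero, mul_pow, ← Complex.ofReal_pow, supportFun_real_smul G hGne (by positivity)]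
  simp_rw [h2]
  rw [mul_comm]
  exact Real.circleAverage_fun_smul (a := r ^ q) (f := fun z => supportFun G hGne (z ^ q))

theorem finite_zeros_closedBall {f : ℂ → ℂ} (hf : Differentiable ℂ f) {z₀ : ℂ} (h0 : f z₀ ≠ 0)
    (r : ℝ) : {z : ℂ | z ∈ Metric.closedBall 0 r ∧ f z = 0}.Finite := by
  have h1 : {z : ℂ | f z ≠ 0} ∈ codiscreteWithin (Metric.closedBall (0 : ℂ) r) :=
    codiscreteWithin_mono (Set.subset_univ _) (eventually_codiscrete_ne_zero hf h0)
  refine ((isCompact_closedBall 0 r).finite_sdiff_of_mem_codiscreteWithin h1).subset ?_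
  rintro z ⟨hz, hz0⟩
  exact ⟨hz, fun h => h hz0⟩

theorem zeroCount_eq_sum {f : ℂ → ℂ} {t : ℝ} {Z : Finset ℂ}
    (hZ : ∀ u, f u = 0 → ‖u‖ ≤ t → u ∈ Z) :
    zeroCount f t = ∑ u ∈ Z.filter (fun u => ‖u‖ ≤ t), analyticOrderNatAt f u := by
  rw [zeroCount, finsum_mem_def]
  rw [finsum_eq_sum_of_support_subset (s := Z.filter fun u => ‖u‖ ≤ t)]
  · refine Finset.sum_congr rfl fun u hu => ?_
    rw [Set.indicator_of_mem]
    rw [mem_closedBall_zero_iff]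
    exact (Finset.mem_filter.1 hu).2
  · intro u hu
    rw [Function.mem_support] at hu
    have h1 : u ∈ Metric.closedBall (0 : ℂ) t := Set.mem_of_indicator_ne_zero hu
    rw [Set.indicator_of_mem h1] at hu
    rw [mem_closedBall_zero_iff] at h1
    exact Finset.mem_coe.2 (Finset.mem_filter.2
      ⟨hZ u (apply_eq_zero_of_analyticOrderNatAt_ne_zero hu) h1, h1⟩)

theorem divisor_closedBall_apply {f : ℂ → ℂ} (hf : Differentiable ℂ f) {z₀ : ℂ} (h0 : f z₀ ≠ 0)
    {t : ℝ} {u : ℂ} (hu : ‖u‖ ≤ t) :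
    MeromorphicOn.divisor f (Metric.closedBall 0 t) u = analyticOrderNatAt f u := by
  have han : AnalyticOnNhd ℂ f (Metric.closedBall 0 t) := fun z _ => hf.analyticAt z
  have htop : analyticOrderAt f u ≠ ⊤ := by
    rw [Ne, AnalyticOnNhd.analyticOrderAt_eq_top_iff_eq_zero u fun z => hf.analyticAt z]
    rintro rfl
    exact h0 rfl
  rw [MeromorphicOn.AnalyticOnNhd.divisor_apply han (by simpa using hu),
    ← Nat.cast_analyticOrderNatAt htop]
  simp

/-- Jensen's formula as a finite sum over zeros, valid also if `f 0 = 0`. -/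
theorem circleAverage_log_norm_eq_sum {f : ℂ → ℂ} (hf : Differentiable ℂ f) {z₀ : ℂ}
    (h0 : f z₀ ≠ 0) {t : ℝ} (ht : 0 < t) {Z : Finset ℂ} (hZ : ∀ u, f u = 0 → ‖u‖ ≤ t → u ∈ Z) :
    Real.circleAverage (fun z => Real.log ‖f z‖) 0 t =
      ∑ u ∈ Z.filter (fun u => ‖u‖ ≤ t),
        (analyticOrderNatAt f u : ℝ) * (Real.log t - Real.log ‖u‖) +
      Real.log ‖meromorphicTrailingCoeffAt f 0‖ := by
  have hmer : MeromorphicOn f (Metric.closedBall 0 |t|) := fun z _ =>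
    (hf.analyticAt z).meromorphicAt
  have hfin : (MeromorphicOn.divisor f (Metric.closedBall 0 |t|)).support.Finite :=
    (MeromorphicOn.divisor f _).finiteSupport (isCompact_closedBall 0 |t|)
  rw [MeromorphicOn.circleAverage_log_norm ht.ne' hmer,
    ← countingFunction_finsum_eq_finsum_add ht.ne' hfin]
  congr 1
  rw [abs_of_pos ht]
  rw [finsum_eq_sum_of_support_subset (s := Z.filter fun u => ‖u‖ ≤ t)]
  · refine Finset.sum_congr rfl fun u hu => ?_
    rw [divisor_closedBall_apply hf h0 (Finset.mem_filter.1 hu).2, zero_sub, norm_neg]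
    simp
  · intro u hu
    rw [Function.mem_support] at hu
    have h1 : MeromorphicOn.divisor f (Metric.closedBall 0 t) u ≠ 0 := by
      intro h
      rw [h, Int.cast_zero, zero_mul] at hu
      exact hu rfl
    have h2 : ‖u‖ ≤ t := by
      by_contra h
      exact h1 (Function.locallyFinsuppWithin.apply_eq_zero_of_notMem _ (by simpa using h))
    rw [divisor_closedBall_apply hf h0 h2] at h1
    exact Finset.mem_coe.2 (Finset.mem_filter.2
      ⟨hZ u (apply_eq_zero_of_analyticOrderNatAt_ne_zero (by exact_mod_cast h1)) h2, h2⟩)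

/-- The increments of the circle averages of `log |f|` are controlled by the number of zeros. -/
theorem zeroCount_mul_log_le {f : ℂ → ℂ} (hf : Differentiable ℂ f) {z₀ : ℂ} (h0 : f z₀ ≠ 0)
    {r s : ℝ} (hr : 0 < r) (hrs : r ≤ s) :
    zeroCount f r * Real.log (s / r) ≤ Real.circleAverage (fun z => Real.log ‖f z‖) 0 s -
        Real.circleAverage (fun z => Real.log ‖f z‖) 0 r ∧
      Real.circleAverage (fun z => Real.log ‖f z‖) 0 s -
        Real.circleAverage (fun z => Real.log ‖f z‖) 0 r ≤ zeroCount f s * Real.log (s / r) := by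
  have hs : 0 < s := hr.trans_le hrs
  set Z := (finite_zeros_closedBall hf h0 s).toFinset with hZdef
  have hZs : ∀ u, f u = 0 → ‖u‖ ≤ s → u ∈ Z := fun u hu hus => by
    rw [hZdef, Set.Finite.mem_toFinset]
    exact ⟨by simpa using hus, hu⟩
  have hZr : ∀ u, f u = 0 → ‖u‖ ≤ r → u ∈ Z := fun u hu hur => hZs u hu (hur.trans hrs)
  rw [circleAverage_log_norm_eq_sum hf h0 hs hZs, circleAverage_log_norm_eq_sum hf h0 hr hZr,
    zeroCount_eq_sum hZs, zeroCount_eq_sum hZr, add_sub_add_right_eq_sub]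
  push_cast
  rw [Finset.sum_mul, Finset.sum_mul, Finset.sum_filter, Finset.sum_filter, Finset.sum_filter,
    Finset.sum_filter, ← Finset.sum_sub_distrib, Real.log_div hs.ne' hr.ne']
  have hlog : Real.log r ≤ Real.log s := Real.log_le_log hr hrs
  constructor <;> refine Finset.sum_le_sum fun u _ => ?_
  · have hm : (0 : ℝ) ≤ analyticOrderNatAt f u := by positivity
    by_cases hur : ‖u‖ ≤ r
    · rw [if_pos hur, if_pos hur, if_pos (hur.trans hrs)]
      apply le_of_eq
      ring
    · rw [if_neg hur, if_neg hur]
      split_ifs with hus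
      · rw [sub_zero]
        refine mul_nonneg hm (sub_nonneg.2 (Real.log_le_log ?_ hus))
        linarith [not_le.1 hur]
      · simp
  · have hm : (0 : ℝ) ≤ analyticOrderNatAt f u := by positivity
    by_cases hur : ‖u‖ ≤ r
    · rw [if_pos hur, if_pos (hur.trans hrs), if_pos (hur.trans hrs)]
      apply le_of_eq
      ring
    · rw [if_neg hur, sub_zero]
      split_ifs with hus
      · have := Real.log_le_log hr (not_le.1 hur).le
        gcongr
      · exact le_rfl

theorem tendsto_exp_mul_sub_one_div (q : ℝ) :
    Tendsto (fun x : ℝ => (Real.exp (q * x) - 1) / x) (nhdsWithin 0 {0}ᶜ) (nhds q) := by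
  have h1 : HasDerivAt (fun x : ℝ => Real.exp (q * x)) q 0 := by
    have := ((hasDerivAt_id (0 : ℝ)).const_mul q).exp
    simpa using this
  have h2 := hasDerivAt_iff_tendsto_slope_zero.1 h1
  refine h2.congr fun x => ?_
  simp [div_eq_inv_mul]

/-- A Tauberian theorem: if the logarithmic increments of `A` are controlled by `n` and
`A r ~ c r ^ q`, then `n r ~ q c r ^ q`. -/
theorem isLittleO_of_log_increments {n A : ℝ → ℝ} {c : ℝ} {q : ℕ}
    (h : ∀ r s, 0 < r → r ≤ s →
      n r * Real.log (s / r) ≤ A s - A r ∧ A s - A r ≤ n s * Real.log (s / r))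
    (hA : (fun r => A r - c * r ^ q) =o[atTop] fun r : ℝ => r ^ q) :
    (fun r => n r - q * c * r ^ q) =o[atTop] fun r : ℝ => r ^ q := by
  rw [Asymptotics.isLittleO_iff]
  intro ε hε
  have hlim : Tendsto (fun x : ℝ => c * ((Real.exp (q * x) - 1) / x)) (nhdsWithin 0 {0}ᶜ)
      (nhds (c * q)) := (tendsto_exp_mul_sub_one_div q).const_mul c
  have hball := hlim (Metric.ball_mem_nhds (c * q) (half_pos hε))
  rw [mem_map, Metric.mem_nhdsWithin_iff] at hball
  obtain ⟨η, hη, hsub⟩ := hball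
  set x := η / 2 with hx
  have hx0 : 0 < x := by positivity
  have hxp := hsub (show x ∈ Metric.ball 0 η ∩ {0}ᶜ from
    ⟨by rw [mem_ball_zero_iff, Real.norm_of_nonneg hx0.le]; linarith, hx0.ne'⟩)
  have hxm := hsub (show -x ∈ Metric.ball 0 η ∩ {0}ᶜ from
    ⟨by rw [mem_ball_zero_iff, norm_neg, Real.norm_of_nonneg hx0.le]; linarith,
      (neg_neg_of_pos hx0).ne⟩)
  rw [Set.mem_preimage, Real.ball_eq_Ioo] at hxp hxm
  set a := Real.exp (q * x) with ha
  set b := Real.exp (q * -x) with hb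
  have ha0 : 0 < a := Real.exp_pos _
  have hb0 : 0 < b := Real.exp_pos _
  have hup : c * (a - 1) ≤ (c * q + ε / 2) * x := by
    have := hxp.2.le
    rw [← mul_div_assoc, div_le_iff₀ hx0] at this
    exact this
  have hlow : (c * q - ε / 2) * x ≤ c * (1 - b) := by
    have := hxm.1.le
    rw [← mul_div_assoc, div_neg, ← neg_div, le_div_iff₀ hx0] at this
    linarith
  set δ := ε / 2 * x / (a + b + 1) with hδ
  have hδ0 : 0 < δ := by positivity
  have hδe : δ * (a + b + 1) = ε / 2 * x := by
    rw [hδ]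
    field_simp
  have hev := (Asymptotics.isLittleO_iff.1 hA) hδ0
  obtain ⟨R, hR⟩ := eventually_atTop.1 hev
  have hexp1 : 1 ≤ Real.exp x := Real.one_le_exp hx0.le
  filter_upwards [eventually_ge_atTop (Real.exp x * |R|), eventually_gt_atTop 0] with r hr hr0
  have hexpm : Real.exp (-x) * Real.exp x = 1 := by
    rw [← Real.exp_add, neg_add_cancel, Real.exp_zero]
  have hrR : |R| ≤ r := (le_mul_of_one_le_left (abs_nonneg R) hexp1).trans hr
  have hrm : |R| ≤ Real.exp (-x) * r := by
    calc |R| = Real.exp (-x) * (Real.exp x * |R|) := by rw [← mul_assoc, hexpm, one_mul]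
      _ ≤ Real.exp (-x) * r := by gcongr
  have hrp : |R| ≤ Real.exp x * r := hrR.trans (le_mul_of_one_le_left hr0.le hexp1)
  have hrq : 0 < r ^ q := by positivity
  have hpow : ∀ y : ℝ, (Real.exp y * r) ^ q = Real.exp (q * y) * r ^ q := fun y => by
    rw [mul_pow, ← Real.exp_nat_mul]
  have e0 := hR r ((le_abs_self R).trans hrR)
  have ep := hR (Real.exp x * r) ((le_abs_self R).trans hrp)
  have em := hR (Real.exp (-x) * r) ((le_abs_self R).trans hrm)
  rw [hpow, ← ha, Real.norm_eq_abs, Real.norm_of_nonneg (by positivity), abs_le] at ep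
  rw [hpow, ← hb, Real.norm_eq_abs, Real.norm_of_nonneg (by positivity), abs_le] at em
  rw [Real.norm_eq_abs, Real.norm_of_nonneg (by positivity), abs_le] at e0
  have h1 := (h r (Real.exp x * r) hr0 (le_mul_of_one_le_left hr0.le hexp1)).1
  have hm1 : Real.exp (-x) * r ≤ r :=
    mul_le_of_le_one_left hr0.le (Real.exp_le_one_iff.2 (by linarith))
  have h2 := (h (Real.exp (-x) * r) r (by positivity) hm1).2
  rw [mul_div_cancel_right₀ _ hr0.ne', Real.log_exp] at h1
  rw [show r / (Real.exp (-x) * r) = Real.exp x by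
    rw [div_mul_cancel_right₀ hr0.ne', Real.exp_neg, inv_inv], Real.log_exp] at h2
  have hδr : δ * (a + b + 1) * r ^ q = ε / 2 * x * r ^ q := by rw [hδe]
  have hup' := mul_le_mul_of_nonneg_right hup hrq.le
  have hlow' := mul_le_mul_of_nonneg_right hlow hrq.le
  have p1 : 0 ≤ δ * a * r ^ q := by positivity
  have p2 : 0 ≤ δ * b * r ^ q := by positivity
  rw [Real.norm_eq_abs, Real.norm_of_nonneg hrq.le, abs_le]
  constructor
  · refine le_of_mul_le_mul_right ?_ hx0
    nlinarith
  · refine le_of_mul_le_mul_right ?_ hx0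
    nlinarith

theorem one_le_expOrder {n : ℕ} {Q : Fin (n + 1) → ℂ[X]} (hQ0 : ∀ j, (Q j).eval 0 = 0)
    (hC : 0 < hullCircumference (conjLeadingCoeffs Q)) : 1 ≤ expOrder Q := by
  classical
  by_contra hlt
  have h0 : expOrder Q = 0 := by omega
  have hG : ∀ a ∈ conjLeadingCoeffs Q, a = 0 := by
    intro a ha
    rw [conjLeadingCoeffs, Finset.mem_image] at ha
    obtain ⟨j, -, rfl⟩ := ha
    rw [h0, coeff_zero_eq_eval_zero, hQ0 j, map_zero]
  rw [hullCircumference_eq_sum] at hC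
  obtain ⟨p, hp, -⟩ := Finset.exists_ne_zero_of_sum_ne_zero hC.ne'
  rw [directedSides, Finset.mem_filter, Finset.mem_product] at hp
  obtain ⟨⟨hp3, hp4⟩, hp2⟩ := hp
  exact hp2.ne ((hG _ hp3).trans (hG _ hp4).symm)

theorem corollary3p3 {n : ℕ} (P Q : Fin (n + 1) → ℂ[X]) (f : ℂ → ℂ)
    (hf : IsExpPolynomial f P Q) (q : ℕ) (hq : expOrder Q = q)
    (hC : 0 < hullCircumference (conjLeadingCoeffs Q)) :
    (fun r : ℝ => (zeroCount f r : ℝ)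
        - q * hullCircumference (conjLeadingCoeffs Q) * (r ^ q / (2 * Real.pi)))
      =o[atTop] (fun r : ℝ => r ^ q) := by
  have hfe : f = expSum Finset.univ P Q := funext hf.eq_sum
  have hq1 : 1 ≤ q := hq ▸ one_le_expOrder hf.exponents_eval_zero hC
  have hdeg : ∀ j, (Q j).natDegree ≤ q := fun j =>
    hq ▸ Finset.le_sup (f := fun j => (Q j).natDegree) (Finset.mem_univ j)
  obtain ⟨⟨z₀, hz₀⟩, hmean⟩ := circleAverage_log_norm_expSum_sub_isLittleO P Q hf.coeff_ne_zero
    hf.exponents_injective hf.exponents_eval_zero hq1 hdeg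
  rw [← hfe] at hz₀ hmean
  have hfd : Differentiable ℂ f := hfe ▸ differentiable_expSum _ P Q
  have hA : (fun r => Real.circleAverage (fun z => Real.log ‖f z‖) 0 r -
      hullCircumference (conjLeadingCoeffs Q) / (2 * Real.pi) * r ^ q)
      =o[atTop] fun r : ℝ => r ^ q := by
    refine hmean.congr' ?_ EventuallyEq.rfl
    filter_upwards [eventually_ge_atTop 0] with r hr
    rw [circleAverage_leadingHeight Q hq hq1 hr]
  refine (isLittleO_of_log_increments (n := fun r => (zeroCount f r : ℝ))
    (fun r s hr hrs => zeroCount_mul_log_le hfd hz₀ hr hrs) hA).congr_left fun r => ?_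
  ring
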